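/- Let $K$ be a perfectoid field of residue characteristic $p$: a field complete with respect to a nonarchimedean absolute value $|\cdot|$ whose value group is not discrete, such that $|p|<1$ and the Frobenius map $x\mapsto x^p$ on $K^\circ/p$ is surjective, where $K^\circ=\{x\in K:|x|\le 1\}$. Let $\varpi\in K$ be a pseudouniformizer, i.e. a nonzero topologically nilpotent element (so $0<|\varpi|<1$), and let $0\le r\le n$ be integers. Put $$\Gamma=\left\{\alpha\in\mathbb Z[1/p]^n:\ \alpha_i\ge 0\text{ for }1\le i\le r\right\},$$ and let $$R=K^\circ\left\langle X_1^{1/p^\infty},\dots,X_r^{1/p^\infty},X_{r+1}^{\pm1/p^\infty},\dots,X_n^{\pm1/p^\infty}\right\rangle$$ be the ring of formal series $\sum_{\alpha\in\Gamma}a_\alpha X^\alpha$ with $a_\alpha\in K^\circ$ such that for every $\varepsilon>0$ only finitely many $\alpha$ satisfy $|a_\alpha|\ge\varepsilon$, with the Cauchy product. Then every finite projective (that is, finitely generated projective) module is free over each of the following rings: 1. the ring $R$; 2. the quotient ring $R/\varpi^dR$, for every integer $d\ge 1$; 3. the ring $(K^\circ/\varpi^d)\left[X_1^{1/p^\infty},\dots,X_r^{1/p^\infty},X_{r+1}^{\pm1/p^\infty},\dots,X_n^{\pm1/p^\infty}\right]$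 of finite sums $\sum_{\alpha\in\Gamma}a_\alpha X^\alpha$ with $a_\alpha\in K^\circ/\varpi^d$, for every integer $d\ge 1$. -/

import Mathlib

open Filter Topology

universe u v

/-! ### Restricted (generalized) power series -/

/-- For a normed ring `A` and an additive monoid `Γ` of exponents, `RestrictedSeries A Γ` is the
ring `A⟨Γ⟩` of formal series `∑ a_γ X^γ` over `γ ∈ Γ` with coefficients in `A` such that for every
`ε > 0` only finitely many coefficients satisfy `‖a_γ‖ ≥ ε`. -/
@[ext]
structure RestrictedSeries (A : Type u) (Γ : Type v) [NormedCommRing A] where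
  coeff : Γ → A
  finite_le_norm : ∀ ε : ℝ, 0 < ε → {γ | ε ≤ ‖coeff γ‖}.Finite

namespace RestrictedSeries

section Additive

variable {A : Type u} {Γ : Type v} [NormedCommRing A]

theorem finite_iff_tendsto {ι : Type*} (f : ι → A) :
    (∀ ε : ℝ, 0 < ε → {i | ε ≤ ‖f i‖}.Finite) ↔ Tendsto f cofinite (𝓝 0) := by
  rw [Metric.tendsto_nhds]
  simp [Filter.eventually_cofinite]

theorem tendsto_coeff (f : RestrictedSeries A Γ) : Tendsto f.coeff cofinite (𝓝 0) :=
  (finite_iff_tendsto _).1 f.finite_le_norm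

/-- The series whose family of coefficients is a given null family. -/
def ofTendsto (f : Γ → A) (hf : Tendsto f cofinite (𝓝 0)) : RestrictedSeries A Γ :=
  ⟨f, (finite_iff_tendsto f).2 hf⟩

theorem coeff_injective : Function.Injective (coeff : RestrictedSeries A Γ → Γ → A) :=
  fun _ _ h => RestrictedSeries.ext h

instance : Zero (RestrictedSeries A Γ) := ⟨ofTendsto 0 tendsto_const_nhds⟩

instance : Add (RestrictedSeries A Γ) :=
  ⟨fun f g => ofTendsto (f.coeff + g.coeff) (by
    have h := f.tendsto_coeff.add g.tendsto_coeff
    rw [add_zero] at h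
    exact h)⟩

instance : Neg (RestrictedSeries A Γ) :=
  ⟨fun f => ofTendsto (-f.coeff) (by
    have h := f.tendsto_coeff.neg
    rw [neg_zero] at h
    exact h)⟩

instance : Sub (RestrictedSeries A Γ) :=
  ⟨fun f g => ofTendsto (f.coeff - g.coeff) (by
    have h := f.tendsto_coeff.sub g.tendsto_coeff
    rw [sub_zero] at h
    exact h)⟩

instance : SMul ℕ (RestrictedSeries A Γ) :=
  ⟨fun n f => ofTendsto (n • f.coeff) (by
    have h := f.tendsto_coeff.const_smul n
    rw [smul_zero] at h
    exact h)⟩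

instance : SMul ℤ (RestrictedSeries A Γ) :=
  ⟨fun n f => ofTendsto (n • f.coeff) (by
    have h := f.tendsto_coeff.const_smul n
    rw [smul_zero] at h
    exact h)⟩

instance : AddCommGroup (RestrictedSeries A Γ) :=
  coeff_injective.addCommGroup coeff rfl (fun _ _ => rfl) (fun _ => rfl) (fun _ _ => rfl)
    (fun _ _ => rfl) (fun _ _ => rfl)

@[simp] theorem coeff_zero (γ : Γ) : (0 : RestrictedSeries A Γ).coeff γ = 0 := rfl

@[simp] theorem coeff_add (f g : RestrictedSeries A Γ) (γ : Γ) :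
    (f + g).coeff γ = f.coeff γ + g.coeff γ := rfl

open Classical in
/-- The monomial `a X^γ`. -/
noncomputable def single (γ : Γ) (a : A) : RestrictedSeries A Γ where
  coeff := Pi.single γ a
  finite_le_norm ε hε := (Set.finite_singleton γ).subset fun δ hδ => by
    by_contra h
    have : ε ≤ 0 := by simpa [Pi.single_eq_of_ne (show δ ≠ γ from h)] using hδ
    linarith

end Additive

section Fibers

variable {A : Type u} [NormedCommRing A] [IsUltrametricDist A]

theorem tendsto_tsum_fiber {ι κ : Type*} (F : ι → A) (hF : Tendsto F cofinite (𝓝 0))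
    (φ : ι → κ) : Tendsto (fun k => ∑' i : {i // φ i = k}, F i) cofinite (𝓝 0) := by
  rw [tendsto_def]
  intro U hU
  obtain ⟨V, hV⟩ := NonarchimedeanAddGroup.is_nonarchimedean U hU
  have hfin : {i | F i ∉ V}.Finite := tendsto_def.1 hF V V.mem_nhds_zero
  rw [mem_cofinite]
  refine (hfin.image φ).subset fun k hk => ?_
  by_contra hne
  refine hk (hV ?_)
  refine tsum_mem V.isClosed (s := V.toAddSubgroup) ?_
  rintro ⟨i, rfl⟩
  by_contra hi
  exact hne ⟨i, hi, rfl⟩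

theorem summable_comp [CompleteSpace A] {ι κ : Type*} (F : ι → A) (hF : Tendsto F cofinite (𝓝 0))
    (e : κ → ι) (he : Function.Injective e) : Summable fun k => F (e k) :=
  (NonarchimedeanAddGroup.summable_of_tendsto_cofinite_zero hF).comp_injective he

end Fibers

section Mul

variable {A : Type u} {Γ : Type v} [NormedCommRing A] [AddCommMonoid Γ]

noncomputable instance : One (RestrictedSeries A Γ) := ⟨single 0 1⟩

variable [IsUltrametricDist A] [CompleteSpace A]

/-- The Cauchy product `(f * g)_γ = ∑_{α + β = γ} f_α g_β`. -/
noncomputable instance : Mul (RestrictedSeries A Γ) :=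
  ⟨fun f g => ofTendsto
    (fun γ => ∑' x : {x : Γ × Γ // x.1 + x.2 = γ}, f.coeff x.1.1 * g.coeff x.1.2)
    (tendsto_tsum_fiber (fun x : Γ × Γ => f.coeff x.1 * g.coeff x.2)
      (tendsto_mul_cofinite_nhds_zero f.tendsto_coeff g.tendsto_coeff) fun x => x.1 + x.2)⟩

theorem coeff_mul (f g : RestrictedSeries A Γ) (γ : Γ) : (f * g).coeff γ =
    ∑' x : {x : Γ × Γ // x.1 + x.2 = γ}, f.coeff x.1.1 * g.coeff x.1.2 := rfl

theorem summable_mul (f g : RestrictedSeries A Γ) (γ : Γ) :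
    Summable fun x : {x : Γ × Γ // x.1 + x.2 = γ} => f.coeff x.1.1 * g.coeff x.1.2 :=
  summable_comp (fun x : Γ × Γ => f.coeff x.1 * g.coeff x.2)
    (tendsto_mul_cofinite_nhds_zero f.tendsto_coeff g.tendsto_coeff) _ Subtype.val_injective

theorem single_mul_single (α β : Γ) (a b : A) :
    single α a * single β b = single (α + β) (a * b) := by
  classical
  ext γ
  rw [coeff_mul]
  by_cases h : α + β = γ
  · subst h
    rw [tsum_eq_single (⟨(α, β), rfl⟩ : {x : Γ × Γ // x.1 + x.2 = α + β})]
    · simp [single]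
    · rintro ⟨⟨x, y⟩, hxy⟩ hne
      by_cases hx : x = α
      · have hy : y ≠ β := fun hy => hne (by subst hx hy; rfl)
        simp [single, Pi.single_eq_of_ne hy]
      · simp [single, Pi.single_eq_of_ne hx]
  · have hz : ∀ x : {x : Γ × Γ // x.1 + x.2 = γ},
        (single α a : RestrictedSeries A Γ).coeff x.1.1 * (single β b).coeff x.1.2 = 0 := by
      rintro ⟨⟨x, y⟩, hxy⟩
      by_cases hx : x = α
      · have hy : y ≠ β := fun hy => h (by subst hx hy; exact hxy)
        simp [single, Pi.single_eq_of_ne hy]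
      · simp [single, Pi.single_eq_of_ne hx]
    rw [tsum_congr hz, tsum_zero]
    simp [single, Pi.single_eq_of_ne (Ne.symm h)]

protected theorem mul_comm' (f g : RestrictedSeries A Γ) : f * g = g * f := by
  ext γ
  rw [coeff_mul, coeff_mul]
  let e : {x : Γ × Γ // x.1 + x.2 = γ} ≃ {x : Γ × Γ // x.1 + x.2 = γ} :=
    (Equiv.prodComm Γ Γ).subtypeEquiv fun x => by simp [add_comm]
  rw [← e.tsum_eq]
  exact tsum_congr fun x => mul_comm _ _

protected theorem one_mul' (f : RestrictedSeries A Γ) : 1 * f = f := by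
  classical
  ext γ
  rw [coeff_mul, tsum_eq_single (⟨(0, γ), zero_add γ⟩ : {x : Γ × Γ // x.1 + x.2 = γ})]
  · change (Pi.single 0 1 : Γ → A) 0 * _ = _
    simp
  · rintro ⟨⟨x, y⟩, hxy⟩ hne
    have hx : x ≠ 0 := by
      rintro rfl
      refine hne ?_
      have : y = γ := by simpa using hxy
      subst this
      rfl
    change (Pi.single 0 1 : Γ → A) x * _ = _
    rw [Pi.single_eq_of_ne hx, zero_mul]

protected theorem mul_add' (f g h : RestrictedSeries A Γ) : f * (g + h) = f * g + f * h := by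
  ext γ
  rw [coeff_add, coeff_mul, coeff_mul, coeff_mul,
    ← (summable_mul f g γ).tsum_add (summable_mul f h γ)]
  exact tsum_congr fun x => by rw [coeff_add, mul_add]

theorem coeff_mul_mul (f g h : RestrictedSeries A Γ) (δ : Γ) : (f * g * h).coeff δ =
    ∑' t : {t : (Γ × Γ) × Γ // t.1.1 + t.1.2 + t.2 = δ},
      f.coeff t.1.1.1 * g.coeff t.1.1.2 * h.coeff t.1.2 := by
  let F : (Γ × Γ) × Γ → A := fun t => f.coeff t.1.1 * g.coeff t.1.2 * h.coeff t.2
  have hF : Tendsto F cofinite (𝓝 0) := tendsto_mul_cofinite_nhds_zero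
    (tendsto_mul_cofinite_nhds_zero f.tendsto_coeff g.tendsto_coeff) h.tendsto_coeff
  let e : (Σ x : {x : Γ × Γ // x.1 + x.2 = δ}, {y : Γ × Γ // y.1 + y.2 = x.1.1}) ≃
      {t : (Γ × Γ) × Γ // t.1.1 + t.1.2 + t.2 = δ} :=
    { toFun := fun s => ⟨(s.2.1, s.1.1.2), by rw [s.2.2, s.1.2]⟩
      invFun := fun t => ⟨⟨(t.1.1.1 + t.1.1.2, t.1.2), t.2⟩, ⟨t.1.1, rfl⟩⟩
      left_inv := by
        rintro ⟨⟨⟨x, y⟩, hx⟩, ⟨z, hz⟩⟩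
        dsimp at hz
        subst hz
        rfl
      right_inv := fun t => rfl }
  have hs' : Summable fun s => F (e s).1 :=
    summable_comp F hF _ (Subtype.val_injective.comp e.injective)
  have h1 : ∑' t : {t : (Γ × Γ) × Γ // t.1.1 + t.1.2 + t.2 = δ}, F t.1 = ∑' s, F (e s).1 :=
    (e.tsum_eq fun t => F t.1).symm
  rw [coeff_mul]
  refine Eq.trans ?_ h1.symm
  rw [hs'.tsum_sigma]
  refine tsum_congr fun x => ?_
  rw [coeff_mul, ← (summable_mul f g x.1.1).tsum_mul_right]
  rfl

protected theorem mul_assoc' (f g h : RestrictedSeries A Γ) : f * g * h = f * (g * h) := by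
  rw [RestrictedSeries.mul_comm' f (g * h)]
  ext δ
  rw [coeff_mul_mul, coeff_mul_mul]
  let e : {t : (Γ × Γ) × Γ // t.1.1 + t.1.2 + t.2 = δ} ≃
      {t : (Γ × Γ) × Γ // t.1.1 + t.1.2 + t.2 = δ} :=
    { toFun := fun t => ⟨((t.1.2, t.1.1.1), t.1.1.2), by
        have h := t.2
        rw [add_comm, ← add_assoc] at h
        exact h⟩
      invFun := fun t => ⟨((t.1.1.2, t.1.2), t.1.1.1), by
        have h := t.2
        rw [add_assoc, add_comm] at h
        exact h⟩
      left_inv := fun t => rfl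
      right_inv := fun t => rfl }
  rw [← e.tsum_eq]
  exact tsum_congr fun t => by
    change f.coeff t.1.2 * g.coeff t.1.1.1 * h.coeff t.1.1.2 =
      g.coeff t.1.1.1 * h.coeff t.1.1.2 * f.coeff t.1.2
    ring

noncomputable instance : CommRing (RestrictedSeries A Γ) :=
  { (inferInstance : AddCommGroup (RestrictedSeries A Γ)) with
    mul := (· * ·)
    one := 1
    mul_assoc := RestrictedSeries.mul_assoc'
    mul_comm := RestrictedSeries.mul_comm'
    one_mul := RestrictedSeries.one_mul'
    mul_one := fun f => by rw [RestrictedSeries.mul_comm', RestrictedSeries.one_mul']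
    left_distrib := RestrictedSeries.mul_add'
    right_distrib := fun f g h => by
      rw [RestrictedSeries.mul_comm', RestrictedSeries.mul_add', RestrictedSeries.mul_comm' h f,
        RestrictedSeries.mul_comm' h g]
    zero_mul := fun f => by
      have h := RestrictedSeries.mul_add' f 0 0
      rw [add_zero, left_eq_add] at h
      rw [RestrictedSeries.mul_comm', h]
    mul_zero := fun f => by
      have h := RestrictedSeries.mul_add' f 0 0
      rwa [add_zero, left_eq_add] at h }

/-- The constant series, as a ring homomorphism `A → A⟨Γ⟩`. -/
noncomputable def C : A →+* RestrictedSeries A Γ where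
  toFun := single 0
  map_one' := rfl
  map_mul' a b := by rw [single_mul_single, add_zero]
  map_zero' := by
    classical
    ext γ
    simp [single]
  map_add' a b := by
    classical
    ext γ
    change (Pi.single 0 (a + b) : Γ → A) γ =
      (Pi.single 0 a : Γ → A) γ + (Pi.single 0 b : Γ → A) γ
    rw [Pi.single_add]
    rfl

end Mul

end RestrictedSeries

/-! ### Exponents in `ℤ[1/p]` -/

/-- The additive group `ℤ[1/p]` of rationals `q` such that `q * p ^ k` is an integer for some
`k`. -/
def zInvP (p : ℕ) : AddSubgroup ℚ where
  carrier := {q | ∃ (k : ℕ) (m : ℤ), q * (p : ℚ) ^ k = m}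
  zero_mem' := ⟨0, 0, by simp⟩
  add_mem' := by
    rintro a b ⟨k, m, h⟩ ⟨l, n, h'⟩
    exact ⟨k + l, m * (p : ℤ) ^ l + n * (p : ℤ) ^ k, by push_cast; rw [← h, ← h']; ring⟩
  neg_mem' := by
    rintro a ⟨k, m, h⟩
    exact ⟨k, -m, by push_cast; rw [← h]; ring⟩

/-- The exponents of the monomials in
`X_1^{1/p^∞}, …, X_r^{1/p^∞}, X_{r+1}^{± 1/p^∞}, …, X_n^{± 1/p^∞}`: the tuples in `ℤ[1/p]^n` whose
first `r` entries are nonnegative. -/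
def perfExponents (p r n : ℕ) : AddSubmonoid (Fin n → ℚ) where
  carrier := {α | ∀ i, α i ∈ zInvP p ∧ (i.val < r → 0 ≤ α i)}
  zero_mem' _ := ⟨(zInvP p).zero_mem, fun _ => le_rfl⟩
  add_mem' ha hb i :=
    ⟨(zInvP p).add_mem (ha i).1 (hb i).1, fun h => add_nonneg ((ha i).2 h) ((hb i).2 h)⟩

/-! ### Perfectoid fields -/

section Field

variable (K : Type u) [NormedField K] [IsUltrametricDist K]

/-- The valuation ring `K° = {x | ‖x‖ ≤ 1}`. -/
noncomputable abbrev valRing : Subring K := (NormedField.valuation (K := K)).integer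

/-- `K` is a perfectoid field of residue characteristic `p`: it is complete with respect to a
nonarchimedean absolute value whose value group is not discrete, `p` lies in the maximal ideal of
`K°`, and the Frobenius map of `K° / p` is surjective. -/
structure IsPerfectoidField (p : ℕ) : Prop where
  prime : p.Prime
  complete : CompleteSpace K
  norm_p_lt_one : ‖(p : K)‖ < 1
  not_discrete : ∀ ε : ℝ, 0 < ε → ∃ x : K, 1 - ε < ‖x‖ ∧ ‖x‖ < 1
  frobenius_surjective :
    Function.Surjective fun x : valRing K ⧸ Ideal.span {(p : valRing K)} => x ^ p

/-- A pseudouniformizer, viewed as an element of `K°`: a topologically nilpotent unit of `K`. -/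
structure IsPseudouniformizer (ϖ : valRing K) : Prop where
  ne_zero : (ϖ : K) ≠ 0
  topologicallyNilpotent : IsTopologicallyNilpotent (ϖ : K)

instance [CompleteSpace K] : CompleteSpace (valRing K) := by
  have h : IsClosed ((valRing K : Subring K) : Set K) := by
    have : ((valRing K : Subring K) : Set K) = {x | ‖x‖ ≤ 1} := by
      ext x
      simp [Valuation.mem_integer_iff, NormedField.valuation_apply, ← NNReal.coe_le_coe]
    rw [this]
    exact isClosed_le continuous_norm continuous_const
  exact h.completeSpace_coe

/-- The ring
`K°⟨X_1^{1/p^∞}, …, X_r^{1/p^∞}, X_{r+1}^{± 1/p^∞}, …, X_n^{± 1/p^∞}⟩`. -/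
abbrev IntegralPerfLaurent (p r n : ℕ) : Type u :=
  RestrictedSeries (valRing K) (perfExponents p r n)

/-- The ring
`(K°/ϖ^d)[X_1^{1/p^∞}, …, X_r^{1/p^∞}, X_{r+1}^{± 1/p^∞}, …, X_n^{± 1/p^∞}]`. -/
abbrev TruncatedPerfLaurent (ϖ : valRing K) (d p r n : ℕ) : Type u :=
  AddMonoidAlgebra (valRing K ⧸ Ideal.span {ϖ ^ d}) (perfExponents p r n)

end Field

/-- Every finite projective `R`-module is free. -/
def FiniteProjectiveFree (R : Type u) [CommRing R] : Prop :=
  ∀ (M : Type v) [AddCommGroup M] [Module R M] [Module.Finite R M] [Module.Projective R M],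
    Module.Free R M

/-!
Write `Γ` for the monoid of exponents, `𝔪` for the maximal ideal of `K°` and `k = K° / 𝔪` for the
residue field. Each of the three rings surjects onto the monoid algebra `k[Γ]` by reducing
coefficients modulo `𝔪`, and every element that reduces to `1` is a unit: for restricted series its
inverse is a geometric series (`RestrictedSeries.isUnit_of_norm_coeff_sub_lt_one`), and the other
two rings are quotients of the ring of restricted series. "Finite projective modules are free" lifts
along such a surjection (`SplitsIdempotents.of_surjective`), so it suffices to treat `k[Γ]`. The
whole argument is phrased with idempotent matrices: `SplitsIdempotents A` says that every idempotent
matrix over `A` is of the form `U * V` with `V * U = 1`.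

If no exponent may be negative, `k[Γ]` is the union of the polynomial rings in `X_i ^ (1 / p ^ M)`,
and the claim is the Quillen–Suslin theorem over a field. In general, let `E` be an idempotent
matrix over `k[Γ]`. It becomes free after inverting some `g` that does not vanish on
`X_1 = ⋯ = X_r = 0`. A monomial change of coordinates, together with multiplication by a monomial,
turns `g` into a nonzero constant plus terms divisible by a monomial `h` in the invertible
variables, with no negative exponents left (`exists_linearEquiv_forall_pos`). Then `g` and `h` are
comaximal in the subring `S` of the elements without negative exponents, while `k[Γ] = S[1/h]`;
gluing `E` over `S[1/h]` with a free module over `S[1/g]` shows that `E` comes from an idempotent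
matrix over `S` (`SplitsIdempotents.splits_of_isCoprime`), where the previous case applies
(`SplitsIdempotents.perfect_laurent`).

The Quillen–Suslin theorem is proved by induction on the number of variables. After a change of
variables, `E` becomes free after inverting a monic polynomial `g ∈ B[X]`, where `B` is a polynomial
ring in one variable less. Clearing denominators gives matrices `α`, `β` with `α * β = g` and
`β * α = g E`; the range of `E` is isomorphic to that of `α`, and the cokernel of `α` is finite
projective over `B`, hence free. Presenting this cokernel also by a characteristic matrix, whose
columns are independent, Schanuel's lemma shows that the range of `E` is stably free
(`Matrix.Splits.of_monic`). Stably free modules are free because unimodular columns over a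
polynomial ring can be completed to invertible matrices, which is Suslin's theorem
(`ColumnEquiv.eval_zero_of_monic`).
-/

/-! ### Splitting idempotent matrices -/

/-- A square matrix `E` splits if `E = U * V` with `V * U = 1`, i.e. if `E` is the projection onto
a free module. -/
def Matrix.Splits {A ι : Type*} [CommRing A] [Fintype ι] (E : Matrix ι ι A) : Prop :=
  ∃ (n : ℕ) (U : Matrix ι (Fin n) A) (V : Matrix (Fin n) ι A), U * V = E ∧ V * U = 1

/-- Every idempotent matrix over `A` splits. This is the form of "finite projective modules are
free" that can be moved along ring homomorphisms by mapping matrices entrywise. -/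
def SplitsIdempotents (A : Type*) [CommRing A] : Prop :=
  ∀ (N : ℕ) (E : Matrix (Fin N) (Fin N) A), E * E = E → E.Splits

namespace Matrix.Splits

variable {A B ι κ : Type*} [CommRing A] [CommRing B] [Fintype ι] [Fintype κ]

theorem map {E : Matrix ι ι A} (h : E.Splits) (f : A →+* B) : (E.map f).Splits := by
  obtain ⟨n, U, V, h1, h2⟩ := h
  refine ⟨n, U.map f, V.map f, ?_, ?_⟩
  · rw [← Matrix.map_mul, h1]
  · rw [← Matrix.map_mul, h2, Matrix.map_one f f.map_zero f.map_one]

theorem of_reindex {E : Matrix ι ι A} (e : ι ≃ κ) (h : (E.submatrix e.symm e.symm).Splits) :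
    E.Splits := by
  obtain ⟨n, U, V, h1, h2⟩ := h
  refine ⟨n, U.submatrix e id, V.submatrix id e, ?_, ?_⟩
  · rw [← Matrix.submatrix_mul _ _ _ _ _ Function.bijective_id, h1, Matrix.submatrix_submatrix]
    simp
  · rw [← Matrix.submatrix_mul _ _ _ _ _ e.bijective, h2]
    simp

/-- If the range of an idempotent matrix is free, then the matrix splits. -/
theorem of_free_range [DecidableEq ι] [Nontrivial A] {E : Matrix ι ι A} (hE : E * E = E)
    [Module.Free A (LinearMap.range E.mulVecLin)] : E.Splits := by
  have : Module.Finite A (LinearMap.range E.mulVecLin) := inferInstance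
  let b := Module.finBasis A (LinearMap.range E.mulVecLin)
  have hfix : ∀ x ∈ LinearMap.range E.mulVecLin, E.mulVecLin x = x := by
    rintro _ ⟨y, rfl⟩
    simp [Matrix.mulVec_mulVec, hE]
  let f : (Fin _ → A) →ₗ[A] (ι → A) :=
    (LinearMap.range E.mulVecLin).subtype ∘ₗ b.equivFun.symm.toLinearMap
  let g : (ι → A) →ₗ[A] (Fin _ → A) := b.equivFun.toLinearMap ∘ₗ E.mulVecLin.rangeRestrict
  refine ⟨_, LinearMap.toMatrix' f, LinearMap.toMatrix' g, ?_, ?_⟩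
  · rw [← LinearMap.toMatrix'_comp]
    have : f ∘ₗ g = E.mulVecLin := by
      ext1 i
      ext j
      simp [f, g]
    rw [this]
    exact LinearMap.toMatrix'_toLin' E
  · rw [← LinearMap.toMatrix'_comp]
    have : g ∘ₗ f = LinearMap.id := by
      refine LinearMap.ext fun x => ?_
      have h1 : E.mulVecLin.rangeRestrict (b.equivFun.symm x : ι → A) = b.equivFun.symm x :=
        Subtype.ext (hfix _ (b.equivFun.symm x).2)
      change b.equivFun (E.mulVecLin.rangeRestrict (b.equivFun.symm x : ι → A)) = x
      rw [h1, LinearEquiv.apply_symm_apply]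
    rw [this, LinearMap.toMatrix'_id]

end Matrix.Splits

section FiniteProjective

variable {A B : Type*} [CommRing A] [CommRing B]

theorem SplitsIdempotents.splits (h : SplitsIdempotents A) {ι : Type*} [Fintype ι]
    {E : Matrix ι ι A} (hE : E * E = E) : E.Splits := by
  classical
  refine Matrix.Splits.of_reindex (Fintype.equivFin ι) (h _ _ ?_)
  rw [← Matrix.submatrix_mul _ _ _ _ _ (Equiv.bijective _), hE]

theorem SplitsIdempotents.free (h : SplitsIdempotents A) (M : Type*) [AddCommGroup M] [Module A M]
    [Module.Finite A M] [Module.Projective A M] : Module.Free A M := by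
  obtain ⟨N, f, hf⟩ := Module.Finite.exists_fin' A M
  obtain ⟨s, hs⟩ := Module.projective_lifting_property f LinearMap.id hf
  have hfs : ∀ x, f (s x) = x := fun x => LinearMap.congr_fun hs x
  have hidem : LinearMap.toMatrix' (s ∘ₗ f) * LinearMap.toMatrix' (s ∘ₗ f) =
      LinearMap.toMatrix' (s ∘ₗ f) := by
    rw [← LinearMap.toMatrix'_comp]
    congr 1
    refine LinearMap.ext fun x => ?_
    simp [hfs]
  obtain ⟨n, U, V, hUV, hVU⟩ := h N _ hidem
  have h1 : ∀ x, U.mulVec (V.mulVec x) = s (f x) := fun x => by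
    rw [Matrix.mulVec_mulVec, hUV]
    exact LinearMap.congr_fun (Matrix.toLin'_toMatrix' (s ∘ₗ f)) x
  have h2 : ∀ x, V.mulVec (U.mulVec x) = x := fun x => by
    rw [Matrix.mulVec_mulVec, hVU, Matrix.one_mulVec]
  refine Module.Free.of_equiv' (inferInstanceAs (Module.Free A (Fin n → A)))
    (LinearEquiv.ofLinearMap (f ∘ₗ U.mulVecLin) (V.mulVecLin ∘ₗ s) ?_ ?_)
  · refine LinearMap.ext fun x => ?_
    simp [h1, hfs]
  · refine LinearMap.ext fun x => ?_
    simp only [LinearMap.comp_apply, Matrix.mulVecLin_apply, LinearMap.id_apply]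
    rw [← h1, h2, h2]

theorem SplitsIdempotents.finiteProjectiveFree {A : Type u} [CommRing A]
    (h : SplitsIdempotents A) : FiniteProjectiveFree.{u, v} A :=
  fun M _ _ _ _ => h.free M

theorem Module.Projective.range_of_idempotent {ι : Type*} [Fintype ι] {E : Matrix ι ι A}
    (hE : E * E = E) : Module.Projective A (LinearMap.range E.mulVecLin) := by
  refine Module.Projective.of_split (LinearMap.range E.mulVecLin).subtype
    E.mulVecLin.rangeRestrict (LinearMap.ext ?_)
  rintro ⟨_, y, rfl⟩
  refine Subtype.ext ?_
  simp [Matrix.mulVec_mulVec, hE]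

theorem SplitsIdempotents.of_isLocalRing [IsLocalRing A] : SplitsIdempotents A := by
  intro N E hE
  have := Module.Projective.range_of_idempotent hE
  have : Module.Free A (LinearMap.range E.mulVecLin) := Module.free_of_flat_of_isLocalRing
  exact .of_free_range hE

theorem SplitsIdempotents.of_ringEquiv (h : SplitsIdempotents A) (e : A ≃+* B) :
    SplitsIdempotents B := by
  intro N E hE
  have h1 := (h N (E.map e.symm) (by rw [← Matrix.map_mul, hE])).map (e : A →+* B)
  rwa [Matrix.map_map, show ((e : A →+* B) : A → B) ∘ e.symm = id from
    funext fun x => e.apply_symm_apply x, Matrix.map_id] at h1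

/-- Idempotent matrices split over a directed union of rings over which they split. -/
theorem SplitsIdempotents.of_forall_finset
    (h : ∀ s : Finset B, ∃ (A : Type u) (_ : CommRing A) (f : A →+* B), Function.Injective f ∧
      SplitsIdempotents A ∧ ∀ x ∈ s, x ∈ f.range) : SplitsIdempotents B := by
  classical
  intro N E hE
  obtain ⟨A, _, f, hf, hA, hs⟩ :=
    h (Finset.univ.image fun ij : Fin N × Fin N => E ij.1 ij.2)
  have h1 : ∀ i j, ∃ a, f a = E i j := fun i j =>
    hs _ (Finset.mem_image.2 ⟨(i, j), Finset.mem_univ _, rfl⟩)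
  choose F hF using h1
  have hFE : (Matrix.of F).map f = E := by
    ext i j
    exact hF i j
  have hF2 : Matrix.of F * Matrix.of F = Matrix.of F := by
    apply Matrix.map_injective hf
    change (Matrix.of F * Matrix.of F).map f = _
    rw [Matrix.map_mul, hFE, hE]
    exact hFE.symm
  rw [← hFE]
  exact (hA N _ hF2).map f

/-- Idempotent matrices split over a ring if they split over a quotient by an ideal contained in
the Jacobson radical. A splitting of the reduction of `E` is lifted to matrices `U`, `V`; after
replacing them by `E * U` and `V * E` the matrix `V * U` is invertible, and `E - U (V U)⁻¹ V` is an
idempotent that vanishes modulo the Jacobson radical, hence is zero. -/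
theorem SplitsIdempotents.of_surjective (hB : SplitsIdempotents B) (f : A →+* B)
    (hf : Function.Surjective f) (hloc : ∀ a, f a = 1 → IsUnit a) : SplitsIdempotents A := by
  have hunit : ∀ {n : ℕ} (M : Matrix (Fin n) (Fin n) A), M.map f = 1 → IsUnit M := by
    intro n M hM
    rw [Matrix.isUnit_iff_isUnit_det]
    refine hloc _ ?_
    rw [RingHom.map_det, RingHom.mapMatrix_apply, hM, Matrix.det_one]
  intro N E hE
  obtain ⟨n, U', V', hUV', hVU'⟩ := hB N (E.map f) (by rw [← Matrix.map_mul, hE])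
  choose g hg using hf
  have hmg : ∀ {k l : ℕ} (W : Matrix (Fin k) (Fin l) B), (W.map g).map f = W := fun W => by
    ext i j
    exact hg _
  have hU'' : E.map f * U' = U' := by rw [← hUV', Matrix.mul_assoc, hVU', Matrix.mul_one]
  have hV'' : V' * E.map f = V' := by rw [← hUV', ← Matrix.mul_assoc, hVU', Matrix.one_mul]
  let U := E * U'.map g
  let V := V'.map g * E
  have hEU : E * U = U := by rw [← Matrix.mul_assoc, hE]
  have hVE : V * E = V := by rw [Matrix.mul_assoc, hE]
  have hUm : U.map f = U' := by rw [Matrix.map_mul, hmg, hU'']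
  have hVm : V.map f = V' := by rw [Matrix.map_mul, hmg, hV'']
  obtain ⟨w, hw⟩ := hunit (V * U) (by rw [Matrix.map_mul, hUm, hVm, hVU'])
  let W : Matrix (Fin n) (Fin n) A := ↑w⁻¹
  have hW1 : W * (V * U) = 1 := by rw [← hw]; exact w.inv_mul
  have hW2 : V * U * W = 1 := by rw [← hw]; exact w.mul_inv
  have hWm : W.map f = 1 := by
    have := congrArg (fun M => M.map f) hW1
    simpa only [Matrix.map_mul, hUm, hVm, hVU', Matrix.mul_one,
      Matrix.map_one f f.map_zero f.map_one] using this
  let F := U * W * V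
  have hEF : E * F = F := by
    simp only [F, ← Matrix.mul_assoc, hEU]
  have hFE : F * E = F := by
    simp only [F, Matrix.mul_assoc, hVE]
  have hFF : F * F = F := by
    calc U * W * V * (U * W * V) = U * W * (V * U * W) * V := by simp only [Matrix.mul_assoc]
      _ = _ := by rw [hW2, Matrix.mul_one]
  have hFm : F.map f = E.map f := by
    simp only [F, Matrix.map_mul, hUm, hVm, hWm, Matrix.mul_one, hUV']
  have hidem : (E - F) * (1 - (E - F)) = 0 := by
    simp only [mul_sub, sub_mul, hE, hEF, hFE, hFF, mul_one]
    abel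
  obtain ⟨x, hx⟩ := hunit (1 - (E - F)) (by
    rw [Matrix.map_sub f f.map_sub, Matrix.map_sub f f.map_sub, hFm, sub_self, sub_zero,
      Matrix.map_one f f.map_zero f.map_one])
  have hzero : E - F = 0 := by
    rw [← hx] at hidem
    exact (Units.mul_left_eq_zero x).1 hidem
  refine ⟨n, U, W * V, ?_, ?_⟩
  · rw [← Matrix.mul_assoc]
    exact (sub_eq_zero.1 hzero).symm
  · rw [Matrix.mul_assoc, hW1]

/-- Over the complement of a prime ideal an idempotent matrix becomes isomorphic to an identity
matrix: the local ring at the prime splits it, and denominators can be cleared. -/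
theorem exists_mul_eq_smul_of_isPrime [IsDomain A] (P : Ideal A) [P.IsPrime] {N : ℕ}
    {E : Matrix (Fin N) (Fin N) A} (hE : E * E = E) :
    ∃ (g : A) (n : ℕ) (α : Matrix (Fin n) (Fin N) A) (β : Matrix (Fin N) (Fin n) A),
      g ∉ P ∧ α * β = g • (1 : Matrix (Fin n) (Fin n) A) ∧ β * α = g • E ∧
      α * E = α ∧ E * β = β := by
  let L := Localization.AtPrime P
  have hinj : Function.Injective (algebraMap A L) :=
    IsLocalization.injective L P.primeCompl_le_nonZeroDivisors
  obtain ⟨n, U, V, hUV, hVU⟩ := SplitsIdempotents.of_isLocalRing (A := L) N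
    (E.map (algebraMap A L)) (by rw [← Matrix.map_mul, hE])
  obtain ⟨⟨d, hd⟩, hdU⟩ := IsLocalization.exist_integer_multiples_of_finite P.primeCompl
    (fun ij : Fin N × Fin n => U ij.1 ij.2)
  obtain ⟨⟨d', hd'⟩, hdV⟩ := IsLocalization.exist_integer_multiples_of_finite P.primeCompl
    (fun ij : Fin n × Fin N => V ij.1 ij.2)
  choose b hb using fun i j => hdU (i, j)
  choose a ha using fun i j => hdV (i, j)
  have hb' : (Matrix.of b).map (algebraMap A L) = d • U := by
    ext i j
    exact hb i j
  have ha' : (Matrix.of a).map (algebraMap A L) = d' • V := by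
    ext i j
    exact ha i j
  have hUE : E.map (algebraMap A L) * U = U := by
    rw [← hUV, Matrix.mul_assoc, hVU, Matrix.mul_one]
  have hVE : V * E.map (algebraMap A L) = V := by
    rw [← hUV, ← Matrix.mul_assoc, hVU, Matrix.one_mul]
  have hmap : ∀ {k l : ℕ} (c : A) (M : Matrix (Fin k) (Fin l) A),
      (c • M).map (algebraMap A L) = c • M.map (algebraMap A L) := fun c M => by
    ext i j
    simp [Algebra.smul_def]
  have hinj' : ∀ {k l : ℕ}, Function.Injective
      (fun M : Matrix (Fin k) (Fin l) A => M.map (algebraMap A L)) :=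
    fun {_ _} => Matrix.map_injective hinj
  refine ⟨d * d', n, Matrix.of a, Matrix.of b, ?_, hinj' ?_, hinj' ?_, hinj' ?_, hinj' ?_⟩
  · exact fun h => (Ideal.IsPrime.mem_or_mem inferInstance h).elim hd hd'
  · simp only [Matrix.map_mul, ha', hb', hmap]
    rw [Matrix.smul_mul, Matrix.mul_smul, hVU, smul_smul, mul_comm,
      Matrix.map_one _ (map_zero _) (map_one _)]
  · simp only [Matrix.map_mul, ha', hb', hmap]
    rw [Matrix.smul_mul, Matrix.mul_smul, hUV, smul_smul]
  · simp only [Matrix.map_mul, ha']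
    rw [Matrix.smul_mul, hVE]
  · simp only [Matrix.map_mul, hb']
    rw [Matrix.mul_smul, hUE]

end FiniteProjective

/-! ### Gluing idempotent matrices along comaximal elements -/

section Gluing

variable {A S : Type*} [CommRing A] [CommRing S]

open Matrix in
/-- Let `A = S[1/h]` and let `g ∈ S` be comaximal with `h`. An idempotent matrix `E` over `A` that
becomes free after inverting `g` comes from an idempotent matrix over `S`, obtained by gluing `E`
over `S[1/h]` with a free module over `S[1/g]`. Hence `E` splits if idempotents over `S` do. -/
theorem SplitsIdempotents.splits_of_isCoprime (hS : SplitsIdempotents S) (j : S →+* A)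
    (hj : Function.Injective j) {h g : S} (hh : IsUnit (j h))
    (hden : ∀ a : A, ∃ c : ℕ, j h ^ c * a ∈ j.range) (hgh : IsCoprime h g)
    {N n : ℕ} {E : Matrix (Fin N) (Fin N) A} (hE : E * E = E)
    {α : Matrix (Fin n) (Fin N) A} {β : Matrix (Fin N) (Fin n) A}
    (hαβ : α * β = j g • (1 : Matrix (Fin n) (Fin n) A)) (hβα : β * α = j g • E)
    (hαE : α * E = α) (hEβ : E * β = β) : E.Splits := by
  classical
  have hden' : ∀ s : Finset A, ∃ c : ℕ, ∀ a ∈ s, j h ^ c * a ∈ j.range := by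
    intro s
    choose c hc using hden
    refine ⟨s.sup c, fun a ha => ?_⟩
    obtain ⟨m, hm⟩ := Nat.exists_eq_add_of_le (Finset.le_sup (f := c) ha)
    rw [hm, pow_add, mul_right_comm, mul_comm]
    exact mul_mem ⟨h ^ m, map_pow j h m⟩ (hc a)
  obtain ⟨u, hu⟩ := hh
  obtain ⟨c, hc⟩ := hden' (Finset.univ.image fun x : Fin n × Fin N => α x.1 x.2)
  -- The glued module is the `S`-span of the columns of `[h ^ c α | g]`, the lower half of `G`, for a
  -- power `h ^ c` that clears the denominators of `α`. With `t = h ^ (-c)`, the presentation of this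
  -- module by these columns is split over `S[1/h]` by the idempotent `T` and over `S[1/g]` by the
  -- idempotent `g⁻¹ G`. For `x h ^ m + y g = 1` the combination `Q = x h ^ m T + y G` is an
  -- idempotent over `S` that splits it globally.
  let t : A := ↑(u⁻¹ ^ c)
  have htc : t * j h ^ c = 1 := by
    rw [← hu, ← Units.val_pow_eq_pow_val, ← Units.val_mul, inv_pow, inv_mul_cancel, Units.val_one]
  have htc' : j h ^ c * t = 1 := by rw [mul_comm, htc]
  have htg : t * (j h ^ c * j g) = j g := by rw [← mul_assoc, htc, one_mul]
  have htg' : j h ^ c * (j g * t) = j g := by linear_combination (j g) * htc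
  let T : Matrix (Fin N ⊕ Fin n) (Fin N ⊕ Fin n) A := fromBlocks E (t • β) 0 0
  let G : Matrix (Fin N ⊕ Fin n) (Fin N ⊕ Fin n) A :=
    fromBlocks 0 0 (j h ^ c • α) (j g • (1 : Matrix (Fin n) (Fin n) A))
  obtain ⟨m, hm⟩ := hden' (Finset.univ.image fun x : (Fin N ⊕ Fin n) × (Fin N ⊕ Fin n) =>
    T x.1 x.2)
  obtain ⟨x, y, hxy⟩ : IsCoprime (h ^ m) g := hgh.pow_left
  have hxy' : j x * j h ^ m + j y * j g = 1 := by
    simpa using congrArg j hxy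
  have hTT : T * T = T := by
    simp [T, fromBlocks_multiply, hE, hEβ]
  have hGG : G * G = j g • G := by
    simp [G, fromBlocks_multiply, fromBlocks_smul, smul_comm (j h ^ c) (j g)]
  have hGT : G * T = G := by
    simp [T, G, fromBlocks_multiply, hαE, hαβ, smul_smul, htg]
  have hTG : T * G = j g • T := by
    simp [T, G, fromBlocks_multiply, fromBlocks_smul, hβα, smul_smul, htg', mul_comm t (j g)]
  let Q := (j x * j h ^ m) • T + j y • G
  have hQQ : Q * Q = Q := by
    have : Q * Q = (j x * j h ^ m) • ((j x * j h ^ m + j y * j g) • T) +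
        j y • ((j x * j h ^ m + j y * j g) • G) := by
      simp only [Q, Matrix.add_mul, Matrix.mul_add, Matrix.smul_mul, Matrix.mul_smul, hTT, hGG,
        hGT, hTG]
      module
    rw [this, hxy', one_smul, one_smul]
  have hQrange : ∀ i k, ∃ s, j s = Q i k := by
    intro i k
    refine add_mem (S := Subring A) (s := j.range) ?_ (mul_mem ⟨y, rfl⟩ ?_)
    · change j x * j h ^ m * T i k ∈ j.range
      rw [mul_assoc]
      exact mul_mem ⟨x, rfl⟩
        (hm _ (Finset.mem_image.2 ⟨(i, k), Finset.mem_univ _, rfl⟩))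
    · rcases i with i | i <;> rcases k with k | k
      · exact zero_mem _
      · exact zero_mem _
      · exact hc _ (Finset.mem_image.2 ⟨(i, k), Finset.mem_univ _, rfl⟩)
      · refine mul_mem ⟨g, rfl⟩ ?_
        by_cases hik : i = k
        · rw [hik, Matrix.one_apply_eq]
          exact one_mem _
        · simp [Matrix.one_apply_ne hik, zero_mem]
  choose F hF using hQrange
  have hFQ : (Matrix.of F).map j = Q := by
    ext i k
    exact hF i k
  obtain ⟨k, U, V, hUV, hVU⟩ := (hS.splits (E := Matrix.of F) (by
    apply Matrix.map_injective hj
    change (Matrix.of F * Matrix.of F).map j = _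
    rw [Matrix.map_mul, hFQ, hQQ]
    exact hFQ.symm)).map j
  rw [hFQ] at hUV
  -- `R` and `Q * L` identify the images of `Q` and `E` over `A`.
  let R : Matrix (Fin N) (Fin N ⊕ Fin n) A := fromCols E (t • β)
  let L : Matrix (Fin N ⊕ Fin n) (Fin N) A := fromRows E 0
  have hRT : R * T = R := by
    simp [R, T, fromCols_mul_fromBlocks, hE, hEβ]
  have hRG : R * G = j g • R := by
    simp only [R, G, fromCols_mul_fromBlocks]
    ext i (k | k)
    · simp [hβα, smul_smul, ← mul_assoc, htc']
    · simp
  have hRQ : R * Q = R := by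
    have : R * Q = (j x * j h ^ m + j y * j g) • R := by
      simp only [Q, Matrix.mul_add, Matrix.mul_smul, hRT, hRG]
      module
    rw [this, hxy', one_smul]
  have hRL : R * L = E := by
    simp [R, L, fromCols_mul_fromRows, hE]
  have hLR : L * R = T := by
    simp only [R, L, T, fromRows_mul_fromCols, hE, Matrix.zero_mul, Matrix.mul_smul, hEβ,
      smul_zero]
  have hQT : Q * T = Q := by
    simp only [Q, Matrix.add_mul, Matrix.smul_mul, hTT, hGT]
  refine ⟨k, R * U, V * L, ?_, ?_⟩
  · calc R * U * (V * L) = R * (U * V) * L := by simp only [Matrix.mul_assoc]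
      _ = E := by rw [hUV, hRQ, hRL]
  · calc V * L * (R * U) = V * U * V * (L * R) * U * (V * U) := by
          rw [hVU]; simp only [Matrix.mul_assoc, Matrix.one_mul, Matrix.mul_one]
      _ = V * ((U * V) * T) * (U * V) * U := by
          rw [hLR]; simp only [Matrix.mul_assoc]
      _ = V * (U * V) * (U * V) * U := by rw [hUV, hQT]
      _ = (V * U) * (V * U) * (V * U) := by simp only [Matrix.mul_assoc]
      _ = 1 := by rw [hVU, Matrix.one_mul, Matrix.one_mul]

end Gluing

/-! ### Unimodular columns over polynomial rings -/

/-- Two columns are equivalent if an invertible matrix carries the first to the second. -/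
def ColumnEquiv {A ι : Type*} [CommRing A] [Fintype ι] [DecidableEq ι] (v w : ι → A) : Prop :=
  ∃ M : Matrix ι ι A, IsUnit M ∧ M.mulVec v = w

namespace ColumnEquiv

variable {A B ι κ : Type*} [CommRing A] [CommRing B] [Fintype ι] [DecidableEq ι] [Fintype κ]
  [DecidableEq κ]

theorem refl (v : ι → A) : ColumnEquiv v v := ⟨1, isUnit_one, Matrix.one_mulVec v⟩

theorem trans {v w x : ι → A} (h : ColumnEquiv v w) (h' : ColumnEquiv w x) : ColumnEquiv v x := by
  obtain ⟨M, hM, rfl⟩ := h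
  obtain ⟨N, hN, rfl⟩ := h'
  exact ⟨N * M, hN.mul hM, (Matrix.mulVec_mulVec v N M).symm⟩

theorem symm {v w : ι → A} (h : ColumnEquiv v w) : ColumnEquiv w v := by
  obtain ⟨M, ⟨M, rfl⟩, rfl⟩ := h
  exact ⟨↑M⁻¹, M⁻¹.isUnit, by rw [Matrix.mulVec_mulVec, Units.inv_mul, Matrix.one_mulVec]⟩

theorem map {v w : ι → A} (h : ColumnEquiv v w) (f : A →+* B) :
    ColumnEquiv (f ∘ v) (f ∘ w) := by
  obtain ⟨M, hM, rfl⟩ := h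
  refine ⟨M.map f, hM.map f.mapMatrix, ?_⟩
  ext i
  exact (f.map_mulVec M v i).symm

theorem comp_equiv {v w : ι → A} (h : ColumnEquiv v w) (e : κ ≃ ι) :
    ColumnEquiv (v ∘ e) (w ∘ e) := by
  obtain ⟨M, hM, rfl⟩ := h
  refine ⟨M.submatrix e e, ?_, ?_⟩
  · rw [Matrix.isUnit_iff_isUnit_det, Matrix.det_submatrix_equiv_self,
      ← Matrix.isUnit_iff_isUnit_det]
    exact hM
  · rw [Matrix.submatrix_mulVec_equiv]
    congr 2
    ext i
    simp

theorem perm (v : ι → A) (e : Equiv.Perm ι) : ColumnEquiv v (v ∘ e) := by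
  refine ⟨e.permMatrix A, ?_, ?_⟩
  · rw [Matrix.isUnit_iff_isUnit_det, Matrix.det_permutation]
    exact (Units.isUnit _).map (Int.castRingHom A)
  · exact Matrix.permMatrix_mulVec e

theorem smul {c : A} (hc : IsUnit c) (v : ι → A) : ColumnEquiv v (c • v) :=
  ⟨c • 1, by
    obtain ⟨u, rfl⟩ := hc
    exact ⟨⟨(u : A) • 1, (↑u⁻¹ : A) • 1, by simp [smul_smul], by simp [smul_smul]⟩, rfl⟩, by
    rw [Matrix.smul_mulVec, Matrix.one_mulVec]⟩

theorem span_range_eq_top {v w : ι → A} (h : ColumnEquiv v w)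
    (hv : Ideal.span (Set.range v) = ⊤) : Ideal.span (Set.range w) = ⊤ := by
  obtain ⟨M, -, rfl⟩ := h.symm
  rw [eq_top_iff, ← hv, Ideal.span_le]
  rintro _ ⟨i, rfl⟩
  exact Ideal.sum_mem _ fun j _ => Ideal.mul_mem_left _ _ (Ideal.subset_span ⟨j, rfl⟩)

end ColumnEquiv

section Suslin

open Polynomial

/-- A unimodular column `(a, b_j)` modulo an ideal `I` contained in only finitely many maximal
ideals can be shortened: some `a + ∑ λ_j b_j` is a unit modulo `I`. By the Chinese remainder
theorem the `λ_j` can be chosen separately at each of these maximal ideals. -/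
theorem exists_sup_span_add_sum_eq_top {R κ : Type*} [CommRing R] [Fintype κ] {I : Ideal R}
    (hI : {P : Ideal R | P.IsMaximal ∧ I ≤ P}.Finite) {a : R} {b : κ → R}
    (h : ∀ P : Ideal R, P.IsMaximal → I ≤ P → a ∈ P → ∃ j, b j ∉ P) :
    ∃ l : κ → R, I ⊔ Ideal.span {a + ∑ j, l j * b j} = ⊤ := by
  classical
  have := hI.to_subtype
  let s := {P : Ideal R | P.IsMaximal ∧ I ≤ P}
  have hcop : Pairwise (Function.onFun IsCoprime fun P : s => (P : Ideal R)) := by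
    intro P Q hPQ
    have := P.2.1
    have := Q.2.1
    exact Ideal.isCoprime_of_isMaximal fun h => hPQ (Subtype.ext h)
  have hex : ∀ P : s, ∃ j : Option κ, a ∈ P.1 ∧ (∃ k, j = some k ∧ b k ∉ P.1) ∨
      a ∉ P.1 ∧ j = none := by
    intro P
    by_cases ha : a ∈ P.1
    · obtain ⟨k, hk⟩ := h P P.2.1 P.2.2 ha
      exact ⟨some k, Or.inl ⟨ha, k, rfl, hk⟩⟩
    · exact ⟨none, Or.inr ⟨ha, rfl⟩⟩
  choose t ht using hex
  choose l hl using fun j : κ =>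
    Ideal.exists_forall_sub_mem_ideal hcop fun P => if t P = some j then (1 : R) else 0
  refine ⟨l, ?_⟩
  by_contra hne
  obtain ⟨P, hP, hle⟩ := Ideal.exists_le_maximal _ hne
  have hmem : a + ∑ j, l j * b j ∈ P :=
    hle (Ideal.mem_sup_right (Ideal.mem_span_singleton_self _))
  let P' : s := ⟨P, hP, le_sup_left.trans hle⟩
  have hmem' : a + ∑ j, (if t P' = some j then (1 : R) else 0) * b j ∈ P := by
    have h1 : a + ∑ j, l j * b j - ∑ j, (l j - if t P' = some j then (1 : R) else 0) * b j ∈ P :=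
      sub_mem hmem (Ideal.sum_mem _ fun j _ => Ideal.mul_mem_right _ _ (hl j P'))
    convert h1 using 1
    simp only [sub_mul, Finset.sum_sub_distrib]
    ring
  rcases ht P' with ⟨ha, k, hk, hb⟩ | ⟨ha, hn⟩
  · refine hb ?_
    simp only [hk, Option.some.injEq, ite_mul, one_mul, zero_mul, Finset.sum_ite_eq,
      Finset.mem_univ, if_true] at hmem'
    exact (P.add_mem_iff_right ha).1 hmem'
  · refine ha ?_
    simpa [hn] using hmem'

/-- The maximal ideals in question are those of `B[X] / (m, f)`, which is a finite algebra over the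
field `B / m`. -/
theorem finite_setOf_isMaximal_map_C_sup_span {B : Type*} [CommRing B] (m : Ideal B)
    [m.IsMaximal] {f : B[X]} (hf : f.Monic) :
    {P : Ideal B[X] | P.IsMaximal ∧ m.map (C : B →+* B[X]) ⊔ Ideal.span {f} ≤ P}.Finite := by
  let I := m.map (C : B →+* B[X]) ⊔ Ideal.span {f}
  have hm : m ≤ I.comap (algebraMap B B[X]) := Ideal.map_le_iff_le_comap.1 le_sup_left
  let _ : Algebra (B ⧸ m) (B[X] ⧸ I) := Ideal.Quotient.algebraQuotientOfLEComap hm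
  have : IsScalarTower B (B ⧸ m) (B[X] ⧸ I) := IsScalarTower.of_algebraMap_eq fun _ => rfl
  have := hf.finite_quotient
  have : Module.Finite B (B[X] ⧸ I) :=
    Module.Finite.of_surjective
      (Ideal.Quotient.factorₐ B (le_sup_right : Ideal.span {f} ≤ I)).toLinearMap
      (Ideal.Quotient.factor_surjective le_sup_right)
  have : Module.Finite (B ⧸ m) (B[X] ⧸ I) := Module.Finite.of_restrictScalars_finite B _ _
  let _ : Field (B ⧸ m) := Ideal.Quotient.field m
  have : IsArtinianRing (B[X] ⧸ I) := IsArtinianRing.of_finite (B ⧸ m) _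
  refine (Set.finite_range fun Q : MaximalSpectrum (B[X] ⧸ I) =>
    Q.asIdeal.comap (Ideal.Quotient.mk I)).subset ?_
  rintro P ⟨hP, hle⟩
  have hker : RingHom.ker (Ideal.Quotient.mk I) ≤ P := by rwa [Ideal.mk_ker]
  have hcm : (P.map (Ideal.Quotient.mk I)).comap (Ideal.Quotient.mk I) = P :=
    Ideal.comap_map_of_surjective' _ Ideal.Quotient.mk_surjective P |>.trans (sup_eq_left.2 hker)
  refine ⟨⟨P.map (Ideal.Quotient.mk I), (Ideal.map_eq_top_or_isMaximal_of_surjective _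
    Ideal.Quotient.mk_surjective hP).resolve_left fun h => hP.ne_top ?_⟩, hcm⟩
  rw [← hcm, h, Ideal.comap_top]

/-- If `f` is monic and `f`, `w` generate the unit ideal modulo a maximal ideal `m` of the base
ring, then by Nakayama's lemma the ideal `(f, w)` contains a constant outside `m`. -/
theorem exists_C_mem_span_pair {B : Type*} [CommRing B] (m : Ideal B)
    [m.IsMaximal] {f w : B[X]} (hf : f.Monic)
    (h : m.map (C : B →+* B[X]) ⊔ Ideal.span {f} ⊔ Ideal.span {w} = ⊤) :
    ∃ c ∉ m, ∃ p q : B[X], p * f + q * w = C c := by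
  let J : Ideal B[X] := Ideal.span {f, w}
  have hfJ : Ideal.span {f} ≤ J := Ideal.span_mono (by simp)
  have := hf.finite_quotient
  have : Module.Finite B (B[X] ⧸ J) :=
    Module.Finite.of_surjective
      (Ideal.Quotient.factorₐ B hfJ).toLinearMap (Ideal.Quotient.factor_surjective hfJ)
  have hJ : m.map (C : B →+* B[X]) ⊔ J = ⊤ := by
    rw [← h, sup_assoc, ← Ideal.span_union, Set.singleton_union]
  have htop : (⊤ : Submodule B (B[X] ⧸ J)) ≤ m • ⊤ := by
    have h1 : m.map (algebraMap B (B[X] ⧸ J)) = ⊤ := by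
      have h2 := congrArg (Ideal.map (Ideal.Quotient.mk J)) hJ
      rw [Ideal.map_sup, Ideal.map_quotient_self, sup_bot_eq, Ideal.map_map, Ideal.map_top] at h2
      exact h2
    rw [Ideal.smul_top_eq_map, h1]
    exact le_rfl
  obtain ⟨c, hc, hc'⟩ := Submodule.exists_sub_one_mem_and_smul_eq_zero_of_fg_of_le_smul m
    (⊤ : Submodule B (B[X] ⧸ J)) Module.Finite.fg_top htop
  refine ⟨c, fun hcm => ?_, ?_⟩
  · exact Ideal.IsPrime.one_notMem (I := m) inferInstance
      (by simpa using sub_mem hcm hc)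
  · have h1 : Ideal.Quotient.mk J (c • 1) = 0 := hc' 1 trivial
    rw [Ideal.Quotient.eq_zero_iff_mem, smul_eq_C_mul, mul_one] at h1
    exact Ideal.mem_span_pair.1 h1

/-- If `C c` is a combination of the first two entries of a column `v` over `B[X]`, then
substituting for `X` two polynomials that are congruent modulo `c` gives equivalent columns. -/
theorem ColumnEquiv.comp_of_dvd_sub {B κ : Type*} [CommRing B] [IsDomain B] [Fintype κ]
    [DecidableEq κ] (v : Fin 2 ⊕ κ → B[X]) {c : B} (hc : c ≠ 0) {p q : B[X]}
    (hpq : p * v (.inl 0) + q * v (.inl 1) = C c) {b b' : B[X]} (hb : C c ∣ b - b') :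
    ColumnEquiv (fun i => (v i).comp b') (fun i => (v i).comp b) := by
  have hdvd : ∀ f : B[X], ∃ d, f.comp b - f.comp b' = C c * d := fun f => by
    refine hb.trans ?_
    have := (f.map (C : B →+* B[X])).sub_dvd_eval_sub b b'
    simpa only [Polynomial.eval_map, Polynomial.comp] using this
  choose d hd using hdvd
  have hdet : ∀ x : B[X], p.comp x * (v (.inl 0)).comp x + q.comp x * (v (.inl 1)).comp x = C c :=
    fun x => by rw [← mul_comp, ← mul_comp, ← add_comp, hpq, C_comp]
  set f := v (.inl 0)
  set g := v (.inl 1)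
  -- `P b` has determinant `C c` and is congruent to `P b'` modulo `c`, so that
  -- `P b * (P b')⁻¹ = 1 + G * adj (P b')` has polynomial entries and determinant one.
  let P : B[X] → Matrix (Fin 2) (Fin 2) B[X] := fun x =>
    !![f.comp x, -q.comp x; g.comp x, p.comp x]
  have hPdet : ∀ x, (P x).det = C c := fun x => by
    rw [Matrix.det_fin_two_of]
    linear_combination hdet x
  let G : Matrix (Fin 2) (Fin 2) B[X] := !![d f, -d q; d g, d p]
  have hG : P b - P b' = C c • G := by
    ext i j
    fin_cases i <;> fin_cases j <;> simp [P, G, ← hd]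
    ring
  let M := 1 + G * (P b').adjugate
  have hM : M * P b' = P b := by
    rw [Matrix.add_mul, Matrix.one_mul, Matrix.mul_assoc, Matrix.adjugate_mul, hPdet,
      Matrix.mul_smul, Matrix.mul_one, ← hG]
    abel
  have hMdet : M.det = 1 := by
    have h1 := congrArg Matrix.det hM
    rw [Matrix.det_mul, hPdet, hPdet] at h1
    exact mul_right_cancel₀ (C_ne_zero.2 hc) (h1.trans (one_mul _).symm)
  let L : Matrix κ (Fin 2) B[X] := Matrix.of fun k => ![d (v (.inr k)) * p.comp b',
    d (v (.inr k)) * q.comp b']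
  refine ⟨Matrix.fromBlocks M 0 L 1, ?_, ?_⟩
  · rw [Matrix.isUnit_iff_isUnit_det, Matrix.det_fromBlocks_zero₁₂, hMdet, Matrix.det_one,
      one_mul]
    exact isUnit_one
  · rw [Matrix.fromBlocks_mulVec]
    ext1 (i | k)
    · have h1 := congrFun (congrFun hM i) 0
      rw [Matrix.mul_apply] at h1
      simp only [Sum.elim_inl, Matrix.zero_mulVec, add_zero, Matrix.mulVec, dotProduct,
        Function.comp_apply]
      rw [Fin.sum_univ_two] at h1 ⊢
      fin_cases i <;> exact h1
    · simp only [Sum.elim_inr, Pi.add_apply, Matrix.one_mulVec, Function.comp_apply]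
      simp only [Matrix.mulVec, dotProduct, Fin.sum_univ_two, L, Matrix.of_apply,
        Matrix.cons_val_zero, Matrix.cons_val_one, Function.comp_apply]
      linear_combination d (v (.inr k)) * hdet b' - hd (v (.inr k))

/-- **Suslin's theorem**: a unimodular column over `B[X]` with a monic entry is equivalent to its
value at `X = 0`. -/
theorem ColumnEquiv.eval_zero_of_monic {B κ : Type*} [CommRing B] [IsDomain B] [Fintype κ]
    [DecidableEq κ] (v : Fin 2 ⊕ κ → B[X]) (hv : Ideal.span (Set.range v) = ⊤)
    (hmonic : (v (.inl 0)).Monic) : ColumnEquiv v (fun i => C ((v i).eval 0)) := by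
  -- The ideal of all `c` such that `v` takes equivalent values at arguments congruent modulo `c`.
  let I : Ideal B :=
    { carrier := {c | ∀ b b' : B[X], C c ∣ b - b' →
        ColumnEquiv (fun i => (v i).comp b') (fun i => (v i).comp b)}
      zero_mem' := by
        intro b b' h
        rw [C_0, zero_dvd_iff, sub_eq_zero] at h
        rw [h]
        exact .refl _
      add_mem' := by
        rintro c c' hc hc' b b' ⟨q, hq⟩
        refine (hc' (b' + C c' * q) b' ⟨q, by ring⟩).trans (hc b _ ⟨q, ?_⟩)
        rw [C_add] at hq
        linear_combination hq
      smul_mem' := by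
        intro a c hc b b' h
        refine hc b b' (dvd_trans ⟨C a, ?_⟩ h)
        rw [smul_eq_mul, C_mul, mul_comm] }
  suffices hI : I = ⊤ by
    have h1 : (1 : B) ∈ I := hI ▸ trivial
    have h2 := h1 0 X (by simp)
    simpa only [comp_X, comp_zero] using h2
  by_contra hI
  obtain ⟨m, hm, hIm⟩ := Ideal.exists_le_maximal _ hI
  obtain ⟨l, hl⟩ := exists_sup_span_add_sum_eq_top (a := v (.inl 1)) (b := fun k => v (.inr k))
    (finite_setOf_isMaximal_map_C_sup_span m hmonic) (by
      intro P hP hle ha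
      by_contra! hb
      refine hP.ne_top (top_le_iff.1 (hv ▸ Ideal.span_le.2 ?_))
      rintro _ ⟨i | k, rfl⟩
      · fin_cases i
        · exact hle (Ideal.mem_sup_right (Ideal.mem_span_singleton_self _))
        · exact ha
      · exact hb k)
  obtain ⟨c, hcm, p, q, hpq⟩ := exists_C_mem_span_pair m hmonic hl
  refine hcm (hIm fun b b' hb => ?_)
  have hc : c ≠ 0 := fun h => hcm (h ▸ m.zero_mem)
  let v' : Fin 2 ⊕ κ → B[X] := Sum.elim ![v (.inl 0), v (.inl 1) + ∑ k, l k * v (.inr k)]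
    (fun k => v (.inr k))
  have hvv' : ColumnEquiv v v' := by
    refine ⟨Matrix.fromBlocks 1 (Matrix.of ![0, l]) 0 1, ?_, ?_⟩
    · rw [Matrix.isUnit_iff_isUnit_det, Matrix.det_fromBlocks_zero₂₁, Matrix.det_one,
        Matrix.det_one, one_mul]
      exact isUnit_one
    · rw [Matrix.fromBlocks_mulVec]
      ext1 (i | k)
      · fin_cases i <;> simp [v', dotProduct, Matrix.vecHead, Matrix.vecTail]
      · simp [v']
  have hsub : ∀ x : B[X], ColumnEquiv (fun i => (v i).comp x) (fun i => (v' i).comp x) :=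
    fun x => hvv'.map (compRingHom x)
  exact (hsub b').trans
    ((ColumnEquiv.comp_of_dvd_sub v' hc (by simpa [v'] using hpq) hb).trans (hsub b).symm)

end Suslin

/-! ### Making a polynomial monic by a change of variables -/

section ChangeOfVariables

/-- The functional `δ ↦ ∑ δ_i N ^ i` is injective on any given finite set for a suitable `N`. -/
theorem exists_pos_forall_sum_mul_pow_ne_zero {n : ℕ} (D : Finset (Fin n → ℚ)) :
    ∃ N : ℕ, 0 < N ∧ ∀ δ ∈ D, ∑ i, δ i * (N : ℚ) ^ (i : ℕ) = 0 → δ = 0 := by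
  classical
  let P : (Fin n → ℚ) → Polynomial ℚ := fun δ => ∑ i, Polynomial.C (δ i) * Polynomial.X ^ (i : ℕ)
  have hP : ∀ δ, P δ = 0 → δ = 0 := by
    intro δ h
    ext i
    have h1 := congrArg (fun f => Polynomial.coeff f i) h
    simpa [P, Polynomial.coeff_X_pow, Fin.val_inj] using h1
  have hinj : Function.Injective fun N : ℕ => ((N + 1 : ℕ) : ℚ) := fun a b h => by
    simpa using h
  obtain ⟨N, hN⟩ := Infinite.exists_notMem_finset
    ((D.biUnion fun δ => (P δ).roots.toFinset).preimage _ hinj.injOn)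
  refine ⟨N + 1, N.succ_pos, fun δ hδ h => ?_⟩
  by_contra hne
  refine hN (Finset.mem_preimage.2 (Finset.mem_biUnion.2 ⟨δ, hδ, ?_⟩))
  rw [Multiset.mem_toFinset, Polynomial.mem_roots fun h0 => hne (hP δ h0)]
  simpa [P, Polynomial.IsRoot.def, Polynomial.eval_finsetSum] using h

open MvPolynomial in
/-- The endomorphism `X_i ↦ X_i + c X_0 ^ (N ^ i)` for `i ≠ 0`, `X_0 ↦ X_0`. -/
noncomputable def nagataAlgHom (k : Type*) [Field k] (n N : ℕ) (c : k) :
    MvPolynomial (Fin (n + 1)) k →ₐ[k] MvPolynomial (Fin (n + 1)) k :=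
  aeval fun i => if i = 0 then X 0 else X i + C c * X 0 ^ N ^ (i : ℕ)

theorem nagataAlgHom_comp_neg {k : Type*} [Field k] (n N : ℕ) (c : k) :
    (nagataAlgHom k n N c).comp (nagataAlgHom k n N (-c)) = AlgHom.id _ _ := by
  rw [nagataAlgHom, nagataAlgHom, MvPolynomial.comp_aeval, ← MvPolynomial.aeval_X_left]
  ext i v
  cases i using Fin.cases <;> simp

/-- After a change of variables a nonzero polynomial becomes, up to a unit, monic in the first
variable. -/
theorem exists_ringEquiv_isUnit_leadingCoeff {k : Type*} [Field k] {n : ℕ}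
    {f : MvPolynomial (Fin (n + 1)) k} (hf : f ≠ 0) :
    ∃ e : MvPolynomial (Fin (n + 1)) k ≃+* Polynomial (MvPolynomial (Fin n) k),
      IsUnit (e f).leadingCoeff := by
  classical
  let ι : (Fin (n + 1) →₀ ℕ) → Fin (n + 1) → ℚ := fun v i => v i
  obtain ⟨N, hN, hD⟩ := exists_pos_forall_sum_mul_pow_ne_zero
    ((f.support ×ˢ f.support).image fun vw => ι vw.1 - ι vw.2)
  let T : MvPolynomial (Fin (n + 1)) k ≃ₐ[k] MvPolynomial (Fin (n + 1)) k :=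
    AlgEquiv.ofAlgHom (nagataAlgHom k n N 1) (nagataAlgHom k n N (-1))
      (nagataAlgHom_comp_neg n N 1) (by simpa using nagataAlgHom_comp_neg n N (-1 : k))
  let e := (T.trans (MvPolynomial.finSuccEquiv k n)).toRingEquiv
  refine ⟨e, ?_⟩
  let W : (Fin (n + 1) →₀ ℕ) → ℕ := fun v => ∑ i : Fin (n + 1), N ^ (i : ℕ) * v i
  have hW : Set.InjOn W f.support := by
    intro v hv w hw h
    have h1 := hD (ι v - ι w) (Finset.mem_image.2 ⟨(v, w), Finset.mk_mem_product hv hw, rfl⟩) (by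
      have h2 : ((W v : ℕ) : ℚ) = W w := by rw [h]
      simp only [W, Nat.cast_sum, Nat.cast_mul, Nat.cast_pow] at h2
      simp only [Pi.sub_apply, ι, mul_comm _ ((N : ℚ) ^ _), mul_sub, Finset.sum_sub_distrib]
      rw [h2, sub_self])
    ext i
    exact Nat.cast_injective (R := ℚ) (congrFun (sub_eq_zero.1 h1) i)
  let y : Fin (n + 1) → Polynomial (MvPolynomial (Fin n) k) := fun i => e (MvPolynomial.X i)
  have hy : ∀ i, (y i).Monic ∧ (y i).natDegree = N ^ (i : ℕ) := by
    intro i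
    cases i using Fin.cases with
    | zero =>
      have : y 0 = Polynomial.X := by
        simp [y, e, T, nagataAlgHom, MvPolynomial.finSuccEquiv_X_zero]
      rw [this]
      exact ⟨Polynomial.monic_X, by simp⟩
    | succ i =>
      have : y i.succ = Polynomial.X ^ N ^ (i.succ : ℕ) + Polynomial.C (MvPolynomial.X i) := by
        simp [y, e, T, nagataAlgHom, MvPolynomial.finSuccEquiv_X_zero,
          MvPolynomial.finSuccEquiv_X_succ, add_comm]
      rw [this]
      exact ⟨Polynomial.monic_X_pow_add_C _ (pow_pos hN _).ne',
        Polynomial.natDegree_X_pow_add_C⟩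
  let Y : (Fin (n + 1) →₀ ℕ) → Polynomial (MvPolynomial (Fin n) k) := fun v => ∏ i, y i ^ v i
  have hY : ∀ v, (Y v).Monic ∧ (Y v).natDegree = W v := by
    intro v
    refine ⟨Polynomial.monic_prod_of_monic _ _ fun i _ => (hy i).1.pow _, ?_⟩
    rw [Polynomial.natDegree_prod_of_monic _ _ fun i _ => (hy i).1.pow _]
    refine Finset.sum_congr rfl fun i _ => ?_
    rw [(hy i).1.natDegree_pow, (hy i).2, mul_comm]
  have hmon : ∀ v (a : k), e (MvPolynomial.monomial v a) =
      Polynomial.C (MvPolynomial.C a) * Y v := by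
    intro v a
    rw [MvPolynomial.monomial_eq, Finsupp.prod_pow v fun i => MvPolynomial.X i, map_mul, map_prod]
    congr 1
    · simp [e, T, nagataAlgHom, MvPolynomial.finSuccEquiv_apply]
    · exact Finset.prod_congr rfl fun i _ => map_pow e _ _
  have hef : e f = ∑ v ∈ f.support, Polynomial.C (MvPolynomial.C (f.coeff v)) * Y v := by
    conv_lhs => rw [← f.support_sum_monomial_coeff]
    rw [map_sum]
    exact Finset.sum_congr rfl fun v _ => hmon v _
  obtain ⟨v, hv, hmax⟩ := Finset.exists_max_image f.support W
    (MvPolynomial.support_nonempty.2 hf)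
  have hdeg : (e f).natDegree ≤ W v := by
    rw [hef]
    refine Polynomial.natDegree_sum_le_of_forall_le _ _ fun w hw => ?_
    exact (Polynomial.natDegree_C_mul_le _ _).trans ((hY w).2.trans_le (hmax w hw))
  have hcoeff : (e f).coeff (W v) = MvPolynomial.C (f.coeff v) := by
    rw [hef, Polynomial.finsetSum_coeff, Finset.sum_eq_single_of_mem v hv]
    · rw [Polynomial.coeff_C_mul, ← (hY v).2, (hY v).1.coeff_natDegree, mul_one]
    · intro w hw hwv
      rw [Polynomial.coeff_C_mul, Polynomial.coeff_eq_zero_of_natDegree_lt, mul_zero]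
      rw [(hY w).2]
      exact lt_of_le_of_ne (hmax w hw) fun h => hwv (hW hw hv h)
  have hunit : IsUnit ((e f).coeff (W v)) := by
    rw [hcoeff]
    exact (IsUnit.mk0 _ (MvPolynomial.mem_support_iff.1 hv)).map MvPolynomial.C
  rwa [Polynomial.leadingCoeff,
    le_antisymm hdeg (Polynomial.le_natDegree_of_ne_zero hunit.ne_zero)]

end ChangeOfVariables

/-! ### Completion of unimodular columns to invertible matrices -/

section UnimodularColumns

/-- Every unimodular column over `A` is equivalent to the first standard basis vector, i.e. it is
the first column of an invertible matrix. -/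
def UnimodularColumnsTrivial (A : Type*) [CommRing A] : Prop :=
  ∀ (n : ℕ) (v : Fin (n + 1) → A), Ideal.span (Set.range v) = ⊤ →
    ColumnEquiv v (Pi.single 0 1)

theorem ColumnEquiv.single_of_isUnit {A : Type*} [CommRing A] {n : ℕ} {v : Fin (n + 1) → A}
    {i : Fin (n + 1)} (hi : IsUnit (v i)) : ColumnEquiv v (Pi.single 0 1) := by
  obtain ⟨c, hc⟩ := hi
  refine (ColumnEquiv.perm v (Equiv.swap 0 i)).trans ((ColumnEquiv.smul c⁻¹.isUnit _).trans ?_)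
  set w : Fin (n + 1) → A := (↑c⁻¹ : A) • (v ∘ Equiv.swap 0 i) with hw
  have hw0 : w 0 = 1 := by simp [hw, ← hc]
  -- With `u = e₀ - w` the matrix `1 + u e₀ᵀ` maps `w` to `e₀`, and its inverse is `1 - u e₀ᵀ`.
  let u : Fin (n + 1) → A := Pi.single 0 1 - w
  let K : Matrix (Fin (n + 1)) (Fin (n + 1)) A := Matrix.vecMulVec u (Pi.single 0 1)
  have hKK : K * K = 0 := by
    rw [Matrix.vecMulVec_mul_vecMulVec]
    simp [u, hw0]
  refine ⟨1 + K, ⟨⟨1 + K, 1 - K, ?_, ?_⟩, rfl⟩, ?_⟩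
  · simp [mul_sub, add_mul, hKK]
  · simp [mul_add, sub_mul, hKK]
  · rw [Matrix.add_mulVec, Matrix.one_mulVec, Matrix.vecMulVec_mulVec]
    simp [u, hw0]

theorem UnimodularColumnsTrivial.of_field (k : Type*) [Field k] : UnimodularColumnsTrivial k := by
  intro n v hv
  have : ∃ i, v i ≠ 0 := by
    by_contra! h
    have : Set.range v ⊆ {0} := by
      rintro _ ⟨i, rfl⟩
      exact h i
    exact bot_ne_top ((Ideal.span_eq_bot.2 fun x hx => this hx).symm.trans hv)
  obtain ⟨i, hi⟩ := this
  exact .single_of_isUnit hi.isUnit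

theorem UnimodularColumnsTrivial.of_ringEquiv {A B : Type*} [CommRing A] [CommRing B]
    (h : UnimodularColumnsTrivial A) (e : A ≃+* B) : UnimodularColumnsTrivial B := by
  intro n v hv
  have h1 := (h n (e.symm ∘ v) (by
    rw [Set.range_comp]
    have := Ideal.map_span (e.symm : B →+* A) (Set.range v)
    rw [hv, Ideal.map_top] at this
    exact this.symm)).map (e : A →+* B)
  convert h1 using 1
  · ext i
    simp
  · ext i
    refine Fin.cases ?_ (fun i => ?_) i <;> simp

theorem ColumnEquiv.eval_zero_of_isUnit_leadingCoeff {B : Type*} [CommRing B] [IsDomain B] {n : ℕ}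
    (v : Fin (n + 2) → Polynomial B) (hv : Ideal.span (Set.range v) = ⊤) (i : Fin (n + 2))
    (hi : IsUnit (v i).leadingCoeff) :
    ∃ w : Fin (n + 2) → B, ColumnEquiv v (fun j => Polynomial.C (w j)) := by
  obtain ⟨c, hc⟩ := hi
  let e : Fin 2 ⊕ Fin n ≃ Fin (n + 2) :=
    (finSumFinEquiv.trans (finCongr (Nat.add_comm 2 n))).trans (Equiv.swap 0 i)
  have he : e (.inl 0) = i := by
    have h0 : finCongr (Nat.add_comm 2 n) (finSumFinEquiv (.inl 0)) = 0 := Fin.ext rfl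
    simp only [e, Equiv.trans_apply]
    rw [h0, Equiv.swap_apply_left]
  have h1 := ColumnEquiv.smul (c⁻¹.isUnit.map (Polynomial.C : B →+* Polynomial B)) v
  have h2 := h1.comp_equiv e
  have hspan := h1.span_range_eq_top hv
  set v' := Polynomial.C (↑c⁻¹ : B) • v with hv'
  have h3 := ColumnEquiv.eval_zero_of_monic (v' ∘ e)
    (by rwa [e.surjective.range_comp]) (by
      rw [Function.comp_apply, he, hv', Pi.smul_apply, smul_eq_mul, Polynomial.Monic,
        Polynomial.leadingCoeff_mul, Polynomial.leadingCoeff_C, ← hc, Units.inv_mul])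
  have h4 := h3.comp_equiv e.symm
  refine ⟨fun j => (v' j).eval 0, h1.trans ?_⟩
  convert h4 using 1
  · ext1 j
    simp
  · ext1 j
    simp

theorem UnimodularColumnsTrivial.mvPolynomial (k : Type*) [Field k] (n : ℕ) :
    UnimodularColumnsTrivial (MvPolynomial (Fin n) k) := by
  induction n with
  | zero =>
    exact (UnimodularColumnsTrivial.of_field k).of_ringEquiv
      (MvPolynomial.isEmptyAlgEquiv k (Fin 0)).symm.toRingEquiv
  | succ n ih =>
    intro l v hv
    have hne : ∃ i, v i ≠ 0 := by
      by_contra! h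
      have : Set.range v ⊆ {0} := by
        rintro _ ⟨i, rfl⟩
        exact h i
      exact bot_ne_top ((Ideal.span_eq_bot.2 fun x hx => this hx).symm.trans hv)
    obtain ⟨i, hi⟩ := hne
    cases l with
    | zero =>
      have h0 : IsUnit (v 0) := by
        have : Set.range v = {v 0} := by
          ext x
          simp [Fin.exists_fin_one, eq_comm]
        rwa [this, Ideal.span_singleton_eq_top] at hv
      exact .single_of_isUnit h0
    | succ l =>
      obtain ⟨e, he⟩ := exists_ringEquiv_isUnit_leadingCoeff hi
      have hev : Ideal.span (Set.range (e ∘ v)) = ⊤ := by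
        rw [Set.range_comp]
        have := Ideal.map_span (e : _ →+* Polynomial (MvPolynomial (Fin n) k)) (Set.range v)
        rw [hv, Ideal.map_top] at this
        exact this.symm
      obtain ⟨w, hw⟩ := ColumnEquiv.eval_zero_of_isUnit_leadingCoeff _ hev i he
      have hwspan : Ideal.span (Set.range w) = ⊤ := by
        have h1 := congrArg (Ideal.map (Polynomial.evalRingHom 0)) (hw.span_range_eq_top hev)
        rw [Ideal.map_span, Ideal.map_top, ← Set.range_comp] at h1
        convert h1 using 3
        ext1 j
        simp
      have h2 := hw.trans ((ih (l + 1) w hwspan).map Polynomial.C)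
      have h3 := h2.map (e.symm : _ →+* MvPolynomial (Fin (n + 1)) k)
      convert h3 using 1
      · ext1 j
        simp
      · ext1 j
        refine Fin.cases ?_ (fun j => ?_) j <;> simp

end UnimodularColumns

/-! ### Projective modules over polynomial rings -/

/-- **Schanuel's lemma**. -/
theorem nonempty_ker_prod_linearEquiv {A M P Q : Type*} [CommRing A] [AddCommGroup M]
    [AddCommGroup P] [AddCommGroup Q] [Module A M] [Module A P] [Module A Q]
    [Module.Projective A P] [Module.Projective A Q] (f : P →ₗ[A] M) (q : Q →ₗ[A] M)
    (hf : Function.Surjective f) (hq : Function.Surjective q) :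
    Nonempty ((LinearMap.ker f × Q) ≃ₗ[A] (P × LinearMap.ker q)) := by
  obtain ⟨a, ha⟩ := Module.projective_lifting_property q f hq
  obtain ⟨b, hb⟩ := Module.projective_lifting_property f q hf
  have ha' : ∀ x, q (a x) = f x := fun x => LinearMap.congr_fun ha x
  have hb' : ∀ y, f (b y) = q y := fun y => LinearMap.congr_fun hb y
  -- Both sides are the kernel of `(x, y) ↦ f x + q y` on `P × Q`.
  refine ⟨LinearEquiv.ofLinearMap
    (LinearMap.prod ((LinearMap.ker f).subtype ∘ₗ LinearMap.fst A _ _ - b ∘ₗ LinearMap.snd A _ _)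
      (LinearMap.codRestrict (LinearMap.ker q) (LinearMap.snd A _ _ + a ∘ₗ
        ((LinearMap.ker f).subtype ∘ₗ LinearMap.fst A _ _ - b ∘ₗ LinearMap.snd A _ _)) ?_))
    (LinearMap.prod (LinearMap.codRestrict (LinearMap.ker f) (LinearMap.fst A _ _ + b ∘ₗ
        ((LinearMap.ker q).subtype ∘ₗ LinearMap.snd A _ _ - a ∘ₗ LinearMap.fst A _ _)) ?_)
      ((LinearMap.ker q).subtype ∘ₗ LinearMap.snd A _ _ - a ∘ₗ LinearMap.fst A _ _)) ?_ ?_⟩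
  · rintro ⟨⟨x, hx⟩, y⟩
    simp [ha', hb', LinearMap.mem_ker.1 hx]
  · rintro ⟨x, ⟨y, hy⟩⟩
    simp [ha', hb', LinearMap.mem_ker.1 hy]
  · refine LinearMap.ext ?_
    rintro ⟨x, ⟨y, hy⟩⟩
    refine Prod.ext ?_ (Subtype.ext ?_) <;> simp
  · refine LinearMap.ext ?_
    rintro ⟨⟨x, hx⟩, y⟩
    refine Prod.ext (Subtype.ext ?_) ?_ <;> simp

section Cancellation

variable {A : Type*} [CommRing A]

/-- Cancellation: an isomorphism `L × A ≃ A ^ n` sends `(0, 1)` to a unimodular column, which can be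
moved to the first basis vector; dividing by it leaves `L ≃ A ^ (n - 1)`. -/
theorem UnimodularColumnsTrivial.free_of_prod_self [Nontrivial A]
    (hA : UnimodularColumnsTrivial A) {L : Type*} [AddCommGroup L] [Module A L] {n : ℕ}
    (e : (L × A) ≃ₗ[A] (Fin n → A)) : ∃ m, Nonempty (L ≃ₗ[A] (Fin m → A)) := by
  cases n with
  | zero =>
    have h := e.injective (Subsingleton.elim (e (0, 1)) (e 0))
    exact absurd (congrArg Prod.snd h) one_ne_zero
  | succ n =>
    obtain ⟨M, hM, hMv⟩ := hA n (e (0, 1)) (by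
      have h1 : (e.symm (e (0, 1))).2 = 1 := by simp
      have h2 : e (0, 1) = ∑ i, e (0, 1) i • Pi.single i (1 : A) := by
        simp [← Pi.single_smul, Finset.univ_sum_single]
      have h3 : (e.symm (e (0, 1))).2 ∈ Ideal.span (Set.range (e (0, 1))) := by
        rw [congrArg e.symm h2, map_sum, Prod.snd_sum]
        refine Ideal.sum_mem _ fun i _ => ?_
        rw [map_smul, Prod.smul_snd, smul_eq_mul, mul_comm]
        exact Ideal.mul_mem_left _ _ (Ideal.subset_span ⟨i, rfl⟩)
      rwa [h1, ← Ideal.eq_top_iff_one] at h3)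
    have := hM.invertible
    let f := e.trans (Matrix.toLinearEquiv' M this)
    have hf : f (0, 1) = Pi.single 0 1 := hMv
    have hf' : f.symm (Pi.single 0 1) = (0, 1) := by rw [← hf, LinearEquiv.symm_apply_apply]
    -- Both `L` and `A ^ n` are the quotient by the second factor `A`, spanned by `f (0, 1)`.
    let φ : L →ₗ[A] (Fin n → A) :=
      LinearMap.funLeft A A Fin.succ ∘ₗ f.toLinearMap ∘ₗ LinearMap.inl A L A
    let ψ : (Fin n → A) →ₗ[A] L := LinearMap.fst A L A ∘ₗ f.symm.toLinearMap ∘ₗ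
      LinearMap.pi (Fin.cons 0 fun i => LinearMap.proj i)
    have hcons : ∀ u : Fin n → A, LinearMap.pi (Fin.cons 0 fun i => LinearMap.proj i :
        Fin (n + 1) → (Fin n → A) →ₗ[A] A) u = (Fin.cons 0 u : Fin (n + 1) → A) := by
      intro u
      ext i
      refine Fin.cases ?_ (fun i => ?_) i <;> simp
    refine ⟨n, ⟨LinearEquiv.ofLinearMap φ ψ (LinearMap.ext fun u => ?_)
      (LinearMap.ext fun q => ?_)⟩⟩
    · set w := f.symm (Fin.cons 0 u : Fin (n + 1) → A) with hw
      have h1 : f (w.1, 0) = Fin.cons 0 u - w.2 • Pi.single 0 1 := by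
        rw [← hf, ← map_smul, eq_sub_iff_add_eq, ← map_add]
        simp [hw]
      change (fun i : Fin n => f ((f.symm (LinearMap.pi _ u)).1, 0) i.succ) = u
      rw [hcons, ← hw, h1]
      ext i
      simp
    · have h1 : (Fin.cons 0 (fun i : Fin n => f (q, 0) i.succ) : Fin (n + 1) → A) =
          f (q, 0) - f (q, 0) 0 • Pi.single 0 1 := by
        ext i
        refine Fin.cases ?_ (fun i => ?_) i <;> simp
      change (f.symm (LinearMap.pi _ (fun i : Fin n => f (q, 0) i.succ))).1 = q
      rw [hcons, h1, map_sub, map_smul, hf']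
      simp

theorem UnimodularColumnsTrivial.free_of_prod [Nontrivial A]
    (hA : UnimodularColumnsTrivial A) (l : ℕ) : ∀ {L : Type u} [AddCommGroup L] [Module A L] {n : ℕ}
    (_ : (L × (Fin l → A)) ≃ₗ[A] (Fin n → A)), ∃ m, Nonempty (L ≃ₗ[A] (Fin m → A)) := by
  induction l with
  | zero => exact fun {L} _ _ n e => ⟨n, ⟨LinearEquiv.prodUnique.symm.trans e⟩⟩
  | succ l ih =>
    intro L _ _ n e
    let e' : ((L × (Fin l → A)) × A) ≃ₗ[A] (L × (Fin (l + 1) → A)) :=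
      (LinearEquiv.prodAssoc A L (Fin l → A) A).trans
        ((LinearEquiv.refl A L).prodCongr ((LinearEquiv.prodComm A (Fin l → A) A).trans
          (Fin.consLinearEquiv A fun _ : Fin (l + 1) => A)))
    obtain ⟨m, ⟨e''⟩⟩ := hA.free_of_prod_self (e'.trans e)
    exact ih e''

end Cancellation

section Horrocks

open Polynomial

/-- Division by a monic polynomial as a linear map. -/
noncomputable def Polynomial.Monic.divHom {B : Type*} [CommRing B] {g : B[X]} (hg : g.Monic) :
    B[X] →ₗ[B] B[X] where
  toFun p := p /ₘ g
  map_add' p q := by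
    refine hg.isRegular.left ?_
    change g * _ = g * _
    rw [mul_add]
    linear_combination modByMonic_add_div (p + q) g - modByMonic_add_div p g -
      modByMonic_add_div q g - add_modByMonic (q := g) p q
  map_smul' c p := by
    refine hg.isRegular.left ?_
    change g * _ = g * (c • _)
    rw [mul_smul_comm, smul_eq_C_mul, smul_eq_C_mul]
    have h := smul_modByMonic (q := g) c p
    rw [smul_eq_C_mul, smul_eq_C_mul] at h
    linear_combination modByMonic_add_div (C c * p) g - C c * modByMonic_add_div p g - h

/-- Over `B[X]`, a module that is free over `B` with basis `b` is the cokernel of the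
characteristic matrix of multiplication by `X`. -/
theorem ker_linearCombination_eq_range_charmatrix {B M ι : Type*} [CommRing B] [AddCommGroup M]
    [Module B M] [Module B[X] M] [IsScalarTower B B[X] M] [Fintype ι] [DecidableEq ι]
    (b : Module.Basis ι B M) :
    LinearMap.ker (Fintype.linearCombination B[X] b) = LinearMap.range
      (LinearMap.toMatrix b b (Algebra.lsmul B B M (X : B[X]))).charmatrix.mulVecLin := by
  set τ := LinearMap.toMatrix b b (Algebra.lsmul B B M (X : B[X])) with hτ
  have hcol : ∀ j, (X : B[X]) • b j = ∑ i, τ i j • b i := by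
    intro j
    have := b.sum_repr ((X : B[X]) • b j)
    rw [← this]
    refine Finset.sum_congr rfl fun i _ => ?_
    rw [hτ, LinearMap.toMatrix_apply]
    rfl
  have hδ : ∀ j, τ.charmatrix.mulVec (Pi.single j 1) =
      (X : B[X]) • Pi.single j (1 : B[X]) - fun i => C (τ i j) := by
    intro j
    ext1 i
    rw [Matrix.mulVec_single_one, Matrix.col_apply, Matrix.charmatrix_apply, Pi.sub_apply,
      Pi.smul_apply, smul_eq_mul, Matrix.diagonal_apply, Pi.single_apply]
    simp
  have hcomp : ∀ y, Fintype.linearCombination B[X] b (τ.charmatrix.mulVec y) = 0 := by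
    intro y
    have h1 : Fintype.linearCombination B[X] b ∘ₗ τ.charmatrix.mulVecLin = 0 := by
      refine Module.Basis.ext (Pi.basisFun B[X] ι) fun j => ?_
      rw [Pi.basisFun_apply, LinearMap.comp_apply, Matrix.mulVecLin_apply, hδ, map_sub, map_smul,
        Fintype.linearCombination_apply_single, one_smul, hcol, Fintype.linearCombination_apply,
        LinearMap.zero_apply, sub_eq_zero]
      refine Finset.sum_congr rfl fun i _ => ?_
      rw [← algebraMap_smul B[X] (τ i j) (b i)]
      rfl
    exact LinearMap.congr_fun h1 y
  -- Every vector is a constant vector modulo the columns of the characteristic matrix.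
  have hdecomp : ∀ y : ι → B[X], ∃ (c : ι → B) (z : ι → B[X]),
      y = (fun i => C (c i)) + τ.charmatrix.mulVec z := by
    have hX : ∀ c : ι → B, (X : B[X]) • (fun i => C (c i)) =
        (fun i => C (τ.mulVec c i)) + τ.charmatrix.mulVec fun i => C (c i) := by
      intro c
      rw [Matrix.charmatrix, Matrix.sub_mulVec, Matrix.scalar_apply]
      ext1 i
      have h1 := (C : B →+* B[X]).map_mulVec τ c i
      simp only [Pi.add_apply, Pi.sub_apply, Pi.smul_apply, Matrix.mulVec_diagonal, smul_eq_mul]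
      rw [h1]
      simp [Function.comp_def]
    have hadd : ∀ y y' : ι → B[X],
        (∃ (c : ι → B) (z : ι → B[X]), y = (fun i => C (c i)) + τ.charmatrix.mulVec z) →
        (∃ (c : ι → B) (z : ι → B[X]), y' = (fun i => C (c i)) + τ.charmatrix.mulVec z) →
        ∃ (c : ι → B) (z : ι → B[X]), y + y' = (fun i => C (c i)) + τ.charmatrix.mulVec z := by
      rintro _ _ ⟨c, z, rfl⟩ ⟨c', z', rfl⟩
      refine ⟨c + c', z + z', ?_⟩
      rw [Matrix.mulVec_add]
      ext1 i
      simp only [Pi.add_apply, C_add]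
      ring
    have hsingle : ∀ (j : ι) (f : B[X]), ∃ (c : ι → B) (z : ι → B[X]),
        Pi.single j f = (fun i => C (c i)) + τ.charmatrix.mulVec z := by
      intro j f
      induction f using Polynomial.induction_on with
      | C a =>
        refine ⟨Pi.single j a, 0, ?_⟩
        ext1 i
        simp [Pi.single_apply, apply_ite (C : B → B[X])]
      | add p q hp hq =>
        rw [Pi.single_add]
        exact hadd _ _ hp hq
      | monomial k a ih =>
        obtain ⟨c, z, hcz⟩ := ih
        refine ⟨τ.mulVec c, (fun i => C (c i)) + (X : B[X]) • z, ?_⟩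
        rw [Matrix.mulVec_add, Matrix.mulVec_smul, ← add_assoc, ← hX, ← smul_add, ← hcz,
          ← Pi.single_smul, smul_eq_mul, pow_succ, ← mul_assoc, mul_comm X]
    intro y
    rw [← Finset.univ_sum_single y]
    refine Finset.sum_induction _ (fun y => ∃ (c : ι → B) (z : ι → B[X]),
      y = (fun i => C (c i)) + τ.charmatrix.mulVec z) hadd ⟨0, 0, ?_⟩ fun j _ => hsingle j _
    ext1 i
    simp
  refine le_antisymm (fun y hy => ?_) ?_
  · obtain ⟨c, z, rfl⟩ := hdecomp y
    rw [LinearMap.mem_ker, map_add, hcomp, add_zero, Fintype.linearCombination_apply] at hy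
    have hc : c = 0 := by
      have h1 : ∑ i, c i • b i = 0 := by
        rw [← hy]
        refine Finset.sum_congr rfl fun i _ => ?_
        rw [← algebraMap_smul B[X] (c i) (b i)]
        rfl
      ext i
      exact Fintype.linearIndependent_iff.1 b.linearIndependent c h1 i
    refine ⟨z, ?_⟩
    rw [hc]
    ext1 i
    simp
  · rintro _ ⟨z, rfl⟩
    exact hcomp z

/-- Let `M` be the cokernel of `α`. The matrix factorization `(α, β)` of the monic polynomial `g`
makes `M` a direct summand, over `B`, of a finite free module: the inclusion is `β` followed by the
remainder modulo `g`, the retraction is `α` followed by division by `g`. -/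
theorem finite_and_projective_of_matrix_factorization {B : Type*} [CommRing B] [Nontrivial B]
    {N n : ℕ} {E : Matrix (Fin N) (Fin N) B[X]} {α : Matrix (Fin n) (Fin N) B[X]}
    {β : Matrix (Fin N) (Fin n) B[X]} {g : B[X]} (hg : g.Monic)
    (hαβ : α * β = g • (1 : Matrix (Fin n) (Fin n) B[X])) (hβα : β * α = g • E) :
    Module.Finite B ((Fin n → B[X]) ⧸ LinearMap.range α.mulVecLin) ∧
      Module.Projective B ((Fin n → B[X]) ⧸ LinearMap.range α.mulVecLin) := by
  let L := LinearMap.range α.mulVecLin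
  let D := Fin N → degreeLT B g.natDegree
  have : Module.Free B (degreeLT B g.natDegree) :=
    Module.Free.of_equiv (degreeLTEquiv B g.natDegree).symm
  have : Module.Finite B (degreeLT B g.natDegree) :=
    Module.Finite.equiv (degreeLTEquiv B g.natDegree).symm
  let rem : B[X] →ₗ[B] degreeLT B g.natDegree :=
    (modByMonicHom g).codRestrict _ fun p => mem_degreeLT.2
      ((degree_modByMonic_lt p hg).trans_eq (degree_eq_natDegree hg.ne_zero))
  have hrem : ∀ p, (rem p : B[X]) = p %ₘ g := fun p => rfl
  let i₀ : (Fin n → B[X]) →ₗ[B] D :=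
    LinearMap.pi fun j => rem ∘ₗ LinearMap.proj j ∘ₗ β.mulVecLin.restrictScalars B
  have hi₀ : L.restrictScalars B ≤ LinearMap.ker i₀ := by
    rintro _ ⟨y, rfl⟩
    rw [LinearMap.mem_ker]
    ext1 j
    refine Subtype.ext ?_
    change (β.mulVec (α.mulVec y) j) %ₘ g = 0
    rw [Matrix.mulVec_mulVec, hβα, Matrix.smul_mulVec, modByMonic_eq_zero_iff_dvd hg]
    exact ⟨_, rfl⟩
  let i : ((Fin n → B[X]) ⧸ L) →ₗ[B] D :=
    (L.restrictScalars B).liftQ i₀ hi₀ ∘ₗ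
      (Submodule.Quotient.restrictScalarsEquiv B L).symm.toLinearMap
  let r : D →ₗ[B] ((Fin n → B[X]) ⧸ L) :=
    L.mkQ.restrictScalars B ∘ₗ LinearMap.pi fun j => hg.divHom ∘ₗ LinearMap.proj j ∘ₗ
      α.mulVecLin.restrictScalars B ∘ₗ
        LinearMap.pi fun k => (degreeLT B g.natDegree).subtype ∘ₗ LinearMap.proj k
  have hri : r ∘ₗ i = LinearMap.id := by
    refine LinearMap.ext fun x => ?_
    obtain ⟨f, rfl⟩ := L.mkQ_surjective x
    change L.mkQ (fun j => α.mulVec (fun k => (β.mulVec f k) %ₘ g) j /ₘ g) = L.mkQ f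
    have h1 : (fun k => (β.mulVec f k) %ₘ g) =
        β.mulVec f - g • fun k => (β.mulVec f k) /ₘ g := by
      ext1 k
      rw [modByMonic_eq_sub_mul_div]
      rfl
    have h2 : ∀ j, α.mulVec (fun k => (β.mulVec f k) %ₘ g) j /ₘ g =
        f j - α.mulVec (fun k => (β.mulVec f k) /ₘ g) j := by
      intro j
      rw [h1, Matrix.mulVec_sub, Matrix.mulVec_mulVec, hαβ, Matrix.smul_mulVec,
        Matrix.one_mulVec, Matrix.mulVec_smul, ← smul_sub, Pi.smul_apply, smul_eq_mul,
        mul_divByMonic_cancel_left _ hg]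
      rfl
    simp only [h2]
    refine (Submodule.Quotient.eq L).2 ⟨-fun k => (β.mulVec f k) /ₘ g, ?_⟩
    ext1 j
    simp [Matrix.mulVec_neg]
  have hr : Function.Surjective r := fun x => ⟨i x, LinearMap.congr_fun hri x⟩
  exact ⟨Module.Finite.of_surjective r hr, Module.Projective.of_split i r hri⟩

/-- An idempotent matrix over `B[X]` that becomes free after inverting a monic polynomial splits,
provided that idempotents over `B` split and unimodular columns over `B[X]` are trivial. The
cokernel of `α` is free over `B`, so comparing its presentation by `α` with its presentation by a
characteristic matrix shows that the range of `α` is stably free. -/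
theorem Matrix.Splits.of_monic {B : Type*} [CommRing B] [IsDomain B] (hB : SplitsIdempotents B)
    (hcol : UnimodularColumnsTrivial B[X]) {N n : ℕ} {E : Matrix (Fin N) (Fin N) B[X]}
    (hE : E * E = E) {α : Matrix (Fin n) (Fin N) B[X]} {β : Matrix (Fin N) (Fin n) B[X]}
    {g : B[X]} (hg : g.Monic) (hαβ : α * β = g • (1 : Matrix (Fin n) (Fin n) B[X]))
    (hβα : β * α = g • E) (hαE : α * E = α) : E.Splits := by
  let L := LinearMap.range α.mulVecLin
  obtain ⟨hfin, hproj⟩ := finite_and_projective_of_matrix_factorization hg hαβ hβα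
  have := hB.free ((Fin n → B[X]) ⧸ L)
  let b := Module.finBasis B ((Fin n → B[X]) ⧸ L)
  have hker := ker_linearCombination_eq_range_charmatrix b
  set χ := (LinearMap.toMatrix b b
    (Algebra.lsmul B B ((Fin n → B[X]) ⧸ L) (X : B[X]))).charmatrix with hχ
  have hinj : Function.Injective χ.mulVecLin := by
    rw [← LinearMap.ker_eq_bot, LinearMap.ker_eq_bot']
    intro y hy
    exact Matrix.eq_zero_of_mulVec_eq_zero (Matrix.charpoly_monic _).ne_zero hy
  have hsurj : Function.Surjective (Fintype.linearCombination B[X] b) := by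
    intro x
    refine ⟨fun i => C (b.repr x i), ?_⟩
    rw [Fintype.linearCombination_apply]
    conv_rhs => rw [← b.sum_repr x]
    refine Finset.sum_congr rfl fun i _ => ?_
    rw [← algebraMap_smul B[X] (b.repr x i) (b i)]
    rfl
  obtain ⟨e⟩ := nonempty_ker_prod_linearEquiv L.mkQ (Fintype.linearCombination B[X] b)
    L.mkQ_surjective hsurj
  rw [Submodule.ker_mkQ, hker] at e
  let e' := (e.trans ((LinearEquiv.refl B[X] (Fin n → B[X])).prodCongr
    (LinearEquiv.ofInjective χ.mulVecLin hinj).symm)).trans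
      ((LinearEquiv.sumArrowLequivProdArrow _ _ B[X] B[X]).symm.trans
        (LinearEquiv.funCongrLeft B[X] B[X] finSumFinEquiv.symm))
  obtain ⟨m, ⟨e₁⟩⟩ := hcol.free_of_prod _ e'
  let φ : LinearMap.range E.mulVecLin →ₗ[B[X]] L :=
    α.mulVecLin.rangeRestrict ∘ₗ (LinearMap.range E.mulVecLin).subtype
  have hφ : Function.Bijective φ := by
    constructor
    · rw [← LinearMap.ker_eq_bot, LinearMap.ker_eq_bot']
      rintro ⟨_, y, rfl⟩ hy
      have h1 : α.mulVec (E.mulVec y) = 0 := congrArg Subtype.val hy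
      have h2 : g • E.mulVec y = 0 := by
        rw [← Matrix.smul_mulVec, ← hβα, ← hαE, ← Matrix.mulVec_mulVec, ← Matrix.mulVec_mulVec,
          h1, Matrix.mulVec_zero]
      exact Subtype.ext ((smul_eq_zero.1 h2).resolve_left hg.ne_zero)
    · rintro ⟨_, y, rfl⟩
      refine ⟨⟨_, y, rfl⟩, Subtype.ext ?_⟩
      change α.mulVec (E.mulVec y) = α.mulVec y
      rw [Matrix.mulVec_mulVec, hαE]
  have : Module.Free B[X] (LinearMap.range E.mulVecLin) :=
    Module.Free.of_equiv ((LinearEquiv.ofBijective φ hφ).trans e₁).symm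
  exact .of_free_range hE

/-- The **Quillen–Suslin theorem** over a field. An idempotent matrix becomes free after inverting a
nonzero polynomial, and this polynomial can be made monic in the first variable. -/
theorem SplitsIdempotents.mvPolynomial (k : Type*) [Field k] (n : ℕ) :
    SplitsIdempotents (MvPolynomial (Fin n) k) := by
  induction n with
  | zero =>
    exact SplitsIdempotents.of_isLocalRing.of_ringEquiv
      (MvPolynomial.isEmptyAlgEquiv k (Fin 0)).symm.toRingEquiv
  | succ n ih =>
    intro N E hE
    obtain ⟨g, m, α, β, hg, hαβ, hβα, hαE, -⟩ := exists_mul_eq_smul_of_isPrime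
      (⊥ : Ideal (MvPolynomial (Fin (n + 1)) k)) hE
    obtain ⟨e, c, hc⟩ := exists_ringEquiv_isUnit_leadingCoeff (f := g) hg
    let f : MvPolynomial (Fin (n + 1)) k →+* (MvPolynomial (Fin n) k)[X] := e
    have hcol := (UnimodularColumnsTrivial.mvPolynomial k (n + 1)).of_ringEquiv e
    let c' : (MvPolynomial (Fin n) k)[X] := C ↑c⁻¹
    have hmonic : (c' * f g).Monic := by
      rw [Monic, leadingCoeff_mul, leadingCoeff_C]
      change _ * (e g).leadingCoeff = 1
      rw [← hc, Units.inv_mul]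
    have hsmul : ∀ {l l' : ℕ} (M : Matrix (Fin l) (Fin l') (MvPolynomial (Fin (n + 1)) k)),
        (g • M).map f = f g • M.map f := fun M => by
      ext1 i j
      exact map_mul f _ _
    have h1 := Matrix.Splits.of_monic ih hcol (E := E.map f) (α := c' • α.map f) (β := β.map f)
      (by rw [← Matrix.map_mul, hE]) hmonic
      (by rw [Matrix.smul_mul, ← Matrix.map_mul, hαβ, hsmul, smul_smul,
        Matrix.map_one f f.map_zero f.map_one])
      (by rw [Matrix.mul_smul, ← Matrix.map_mul, hβα, hsmul, smul_smul])
      (by rw [Matrix.smul_mul, ← Matrix.map_mul, hαE])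
    have h2 := h1.map (e.symm : _ →+* MvPolynomial (Fin (n + 1)) k)
    convert h2 using 1
    ext1 i j
    simp [f]

end Horrocks

/-! ### Monoid algebras on exponents in `ℤ[1/p]` -/

section Exponents

theorem inv_pow_mem_zInvP {p : ℕ} (hp : p ≠ 0) (M : ℕ) : ((p : ℚ) ^ M)⁻¹ ∈ zInvP p :=
  ⟨M, 1, by rw [inv_mul_cancel₀ (pow_ne_zero _ (Nat.cast_ne_zero.2 hp)), Int.cast_one]⟩

theorem natCast_mul_mem_zInvP {p : ℕ} (c : ℕ) {q : ℚ} (hq : q ∈ zInvP p) :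
    (c : ℚ) * q ∈ zInvP p := by
  rw [← nsmul_eq_mul]
  exact nsmul_mem hq c

instance (k : Type*) [Field k] (p r n : ℕ) :
    IsDomain (AddMonoidAlgebra k (perfExponents p r n)) := by
  have : TwoUniqueSums (perfExponents p r n) :=
    TwoUniqueSums.of_injective_addHom (perfExponents p r n).subtype.toAddHom
      Subtype.val_injective inferInstance
  exact NoZeroDivisors.to_isDomain _

/-- Finitely many affine functions with positive slope are simultaneously positive at some natural
number. -/
theorem exists_nat_forall_add_mul_pos {ι : Type*} (S : Finset ι) (a b : ι → ℚ)
    (hb : ∀ x ∈ S, 0 < b x) : ∃ N : ℕ, ∀ x ∈ S, 0 < a x + N * b x := by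
  choose! N hN using fun x => exists_nat_gt (-a x / b x)
  refine ⟨S.sup N, fun x hx => ?_⟩
  have h1 : -a x / b x < (S.sup N : ℕ) :=
    (hN x).trans_le (Nat.cast_le.2 (Finset.le_sup (f := N) hx))
  rw [div_lt_iff₀ (hb x hx)] at h1
  linarith

theorem exists_inv_pow_le {p : ℕ} (hp : 1 < p) {ι : Type*} (S : Finset ι) (b : ι → ℚ)
    (hb : ∀ x ∈ S, 0 < b x) : ∃ M : ℕ, ∀ x ∈ S, ((p : ℚ) ^ M)⁻¹ ≤ b x := by
  obtain ⟨M, hM⟩ := exists_nat_forall_add_mul_pos S (fun _ => -1) b hb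
  refine ⟨M, fun x hx => ?_⟩
  have h1 : (M : ℚ) ≤ (p : ℚ) ^ M := by exact_mod_cast (Nat.lt_pow_self hp).le
  have h2 : (0 : ℚ) < (p : ℚ) ^ M := by positivity
  rw [inv_le_iff_one_le_mul₀ h2, mul_comm]
  nlinarith [hM x hx, hb x hx]

/-- The shear `x ↦ x + f x • u` along a vector `u` killed by `f`. -/
def shear {n : ℕ} (f : (Fin n → ℚ) →ₗ[ℚ] ℚ) (u : Fin n → ℚ) (h : f u = 0) :
    (Fin n → ℚ) ≃ₗ[ℚ] (Fin n → ℚ) :=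
  LinearEquiv.ofLinearMap (LinearMap.id + f.smulRight u) (LinearMap.id - f.smulRight u)
    (LinearMap.ext fun x => by simp [h]) (LinearMap.ext fun x => by simp [h])

/-- Given a finite set `S` of exponents at least one of which does not involve the first `r`
variables, there are an exponent `α₀ ∈ S` of this kind and a monomial change of coordinates,
fixing the first `r` exponents, after which `α - α₀` has positive coordinates outside the first
`r` for all other `α ∈ S`. Here `α₀` minimizes a generic weight on `S`; the change of coordinates
takes this weight as the coordinate with index `r` and adds a large multiple of it to all later
coordinates. -/
theorem exists_linearEquiv_forall_pos {r n : ℕ} (hrn : r < n) (p : ℕ)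
    (S : Finset (Fin n → ℚ)) (hS : ∀ α ∈ S, ∀ i : Fin n, i.val < r → 0 ≤ α i)
    (hS₀ : ∃ α ∈ S, ∀ i : Fin n, i.val < r → α i = 0) :
    ∃ (Φ : (Fin n → ℚ) ≃ₗ[ℚ] (Fin n → ℚ)), ∃ α₀ ∈ S,
      (∀ δ, (∀ i, δ i ∈ zInvP p) → ∀ i, Φ δ i ∈ zInvP p) ∧
      (∀ δ, (∀ i, δ i ∈ zInvP p) → ∀ i, Φ.symm δ i ∈ zInvP p) ∧
      (∀ δ, ∀ i : Fin n, i.val < r → Φ δ i = δ i) ∧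
      (∀ i : Fin n, i.val < r → α₀ i = 0) ∧
      ∀ α ∈ S, α ≠ α₀ → ∀ i : Fin n, r ≤ i.val → 0 < Φ (α - α₀) i := by
  classical
  let t : Fin n := ⟨r, hrn⟩
  let cut : (Fin n → ℚ) → (Fin n → ℚ) := fun δ i => if i.val < r then 0 else δ i
  obtain ⟨N, hN, hND⟩ := exists_pos_forall_sum_mul_pow_ne_zero
    ((S ×ˢ S).image fun x => cut (x.1 - x.2))
  -- The coordinates from `r` on are weighted by powers of `N`, so that the weight separates the
  -- exponents in `T`; the first `r` coordinates get a weight `Q` that is large enough to put the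
  -- exponents outside `T` above the minimum.
  let w₀ : (Fin n → ℚ) → ℚ := fun δ => ∑ i : Fin n, if i.val < r then 0 else
    (N : ℚ) ^ (i.val - r) * δ i
  have hw₀sub : ∀ α β, w₀ (α - β) = w₀ α - w₀ β := by
    intro α β
    rw [← Finset.sum_sub_distrib]
    refine Finset.sum_congr rfl fun i _ => ?_
    split_ifs
    · rw [sub_zero]
    · rw [Pi.sub_apply, mul_sub]
  have hw₀ : ∀ α ∈ S, ∀ β ∈ S, w₀ (α - β) = 0 → cut (α - β) = 0 := by
    intro α hα β hβ h
    refine hND _ (Finset.mem_image.2 ⟨(α, β), Finset.mk_mem_product hα hβ, rfl⟩) ?_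
    have h1 : ∑ i, cut (α - β) i * (N : ℚ) ^ (i : ℕ) = (N : ℚ) ^ r * w₀ (α - β) := by
      rw [Finset.mul_sum]
      refine Finset.sum_congr rfl fun i _ => ?_
      by_cases hi : i.val < r
      · simp [cut, hi]
      · simp only [cut, if_neg hi]
        rw [← mul_assoc, ← pow_add, Nat.add_sub_cancel' (not_lt.1 hi), mul_comm]
    rw [h1, h, mul_zero]
  let T := S.filter fun α => ∀ i : Fin n, i.val < r → α i = 0
  obtain ⟨α₀, hα₀, hmin⟩ := Finset.exists_min_image T w₀
    (hS₀.imp fun α h => Finset.mem_filter.2 h)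
  obtain ⟨hα₀S, hα₀r⟩ := Finset.mem_filter.1 hα₀
  let s : (Fin n → ℚ) → ℚ := fun δ => ∑ i : Fin n, if i.val < r then δ i else 0
  obtain ⟨Q, hQ⟩ := exists_nat_forall_add_mul_pos (S \ T) (fun α => w₀ (α - α₀)) s (by
    intro α hα
    obtain ⟨hαS, hαT⟩ := Finset.mem_sdiff.1 hα
    have hex : ∃ i : Fin n, i.val < r ∧ α i ≠ 0 := by
      by_contra! h
      exact hαT (Finset.mem_filter.2 ⟨hαS, h⟩)
    obtain ⟨i, hi, hne⟩ := hex
    refine Finset.sum_pos' (fun j _ => ?_) ⟨i, Finset.mem_univ _, ?_⟩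
    · split_ifs with hj
      · exact hS α hαS j hj
      · exact le_rfl
    · rw [if_pos hi]
      exact lt_of_le_of_ne (hS α hαS i hi) hne.symm)
  let c : Fin n → ℕ := fun i => if i.val < r then Q else N ^ (i.val - r)
  let w : (Fin n → ℚ) →ₗ[ℚ] ℚ := ∑ i, (c i : ℚ) • LinearMap.proj i
  have hw : ∀ δ, w δ = ∑ i, (c i : ℚ) * δ i := fun δ => by simp [w]
  have hws : ∀ δ, w δ = w₀ δ + Q * s δ := by
    intro δ
    rw [hw, Finset.mul_sum, ← Finset.sum_add_distrib]
    refine Finset.sum_congr rfl fun i _ => ?_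
    by_cases hi : i.val < r <;> simp [c, hi]
  have hs₀ : s α₀ = 0 := by
    refine Finset.sum_eq_zero fun i _ => ?_
    split_ifs with hi
    · exact hα₀r i hi
    · rfl
  have hssub : ∀ α, s (α - α₀) = s α := by
    intro α
    rw [← sub_zero (s α), ← hs₀, ← Finset.sum_sub_distrib]
    refine Finset.sum_congr rfl fun i _ => ?_
    split_ifs
    · rw [Pi.sub_apply]
    · rw [sub_zero]
  have hwpos : ∀ α ∈ S, α ≠ α₀ → 0 < w (α - α₀) := by
    intro α hα hne
    rw [hws, hssub]
    by_cases hαT : α ∈ T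
    · have hαr := (Finset.mem_filter.1 hαT).2
      have h1 : s α = 0 := by
        refine Finset.sum_eq_zero fun i _ => ?_
        split_ifs with hi
        · exact hαr i hi
        · rfl
      rw [h1, mul_zero, add_zero]
      refine lt_of_le_of_ne (by rw [hw₀sub]; exact sub_nonneg.2 (hmin α hαT)) fun h => hne ?_
      have h2 := hw₀ α hα α₀ hα₀S h.symm
      ext i
      by_cases hi : i.val < r
      · rw [hαr i hi, hα₀r i hi]
      · have h3 := congrFun h2 i
        simp only [cut, if_neg hi, Pi.sub_apply, Pi.zero_apply] at h3
        exact sub_eq_zero.1 h3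
    · exact hQ α (Finset.mem_sdiff.2 ⟨hα, hαT⟩)
  obtain ⟨R, hR⟩ := exists_nat_forall_add_mul_pos (S.erase α₀ ×ˢ (Finset.univ : Finset (Fin n)))
    (fun x => (x.1 - α₀) x.2) (fun x => w (x.1 - α₀)) (by
      rintro ⟨α, i⟩ h
      obtain ⟨hne, hα⟩ := Finset.mem_erase.1 (Finset.mem_product.1 h).1
      exact hwpos α hα hne)
  have hwt : w (Pi.single t 1) = 1 := by
    rw [hw, Finset.sum_eq_single_of_mem t (Finset.mem_univ _)]
    · simp [c, t]
    · intro i _ hi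
      rw [Pi.single_eq_of_ne hi, mul_zero]
  let Φ₁ := shear (w - LinearMap.proj t) (Pi.single t 1) (by simp [hwt])
  let Φ₂ := shear (LinearMap.proj t) (fun i => if r < i.val then (R : ℚ) else 0) (by simp [t])
  have hΦ₁ : ∀ δ, Φ₁ δ = δ + (w δ - δ t) • Pi.single t 1 := fun δ => rfl
  have hΦ₂ : ∀ δ, Φ₂ δ = δ + δ t • fun i => if r < i.val then (R : ℚ) else 0 := fun δ => rfl
  have hwmem : ∀ δ, (∀ i, δ i ∈ zInvP p) → w δ ∈ zInvP p := by
    intro δ hδ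
    rw [hw]
    exact sum_mem fun i _ => natCast_mul_mem_zInvP _ (hδ i)
  have hmem₁ : ∀ δ : Fin n → ℚ, (∀ i, δ i ∈ zInvP p) → ∀ i,
      ((w δ - δ t) • (Pi.single t 1 : Fin n → ℚ)) i ∈ zInvP p := by
    intro δ hδ i
    by_cases hi : i = t
    · subst hi
      simpa using sub_mem (hwmem δ hδ) (hδ t)
    · simp [Pi.single_eq_of_ne hi, zero_mem]
  have hmem₂ : ∀ δ : Fin n → ℚ, (∀ i, δ i ∈ zInvP p) → ∀ i,
      (δ t • fun i : Fin n => if r < i.val then (R : ℚ) else 0) i ∈ zInvP p := by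
    intro δ hδ i
    rw [Pi.smul_apply, smul_eq_mul, mul_comm]
    split_ifs
    · exact natCast_mul_mem_zInvP _ (hδ t)
    · rw [zero_mul]
      exact zero_mem _
  have hΦ₁t : ∀ δ, Φ₁ δ t = w δ := fun δ => by simp [hΦ₁]
  have hΦ₁ne : ∀ δ i, i ≠ t → Φ₁ δ i = δ i := fun δ i hi => by
    simp [hΦ₁, Pi.single_eq_of_ne hi]
  refine ⟨Φ₁.trans Φ₂, α₀, hα₀S, fun δ hδ i => ?_, fun δ hδ i => ?_, fun δ i hi => ?_, hα₀r,
    fun α hα hne i hi => ?_⟩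
  · have h1 : ∀ i, Φ₁ δ i ∈ zInvP p := fun i => add_mem (hδ i) (hmem₁ δ hδ i)
    exact add_mem (h1 i) (hmem₂ _ h1 i)
  · have h1 : ∀ i, Φ₂.symm δ i ∈ zInvP p := fun i => sub_mem (hδ i) (hmem₂ δ hδ i)
    exact sub_mem (h1 i) (hmem₁ _ h1 i)
  · rw [LinearEquiv.trans_apply, hΦ₂, Pi.add_apply, Pi.smul_apply, if_neg (not_lt.2 hi.le),
      smul_zero, add_zero, hΦ₁ne]
    exact fun h => hi.ne (congrArg Fin.val h)
  · rw [LinearEquiv.trans_apply, hΦ₂, Pi.add_apply, Pi.smul_apply, hΦ₁t, smul_eq_mul]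
    by_cases hit : i = t
    · subst hit
      simpa [t, hΦ₁t] using hwpos α hα hne
    · have hri : r < i.val := lt_of_le_of_ne hi fun h => hit (Fin.ext h.symm)
      rw [if_pos hri, hΦ₁ne _ _ hit, mul_comm]
      exact hR (α, i) (Finset.mk_mem_product (Finset.mem_erase.2 ⟨hne, hα⟩) (Finset.mem_univ _))

end Exponents

section MonoidAlgebra

variable {k : Type u} [Field k]

theorem AddMonoidAlgebra.mem_range_mapDomainRingHom {G H : Type*} [AddMonoid G] [AddMonoid H]
    (θ : G →+ H) {x : AddMonoidAlgebra k H} (hx : ∀ γ ∈ x.coeff.support, γ ∈ Set.range θ) :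
    x ∈ (AddMonoidAlgebra.mapDomainRingHom k θ).range := by
  rw [← AddMonoidAlgebra.sum_coeff_single x]
  refine sum_mem fun γ hγ => ?_
  obtain ⟨δ, rfl⟩ := hx γ hγ
  exact ⟨AddMonoidAlgebra.single δ (x.coeff (θ δ)), by simp⟩

/-- Idempotents split over `k[X_1^{1/p^∞}, …, X_n^{1/p^∞}]`, the union of the polynomial rings
`k[X_1^{1/p^M}, …, X_n^{1/p^M}]`. -/
theorem SplitsIdempotents.perfect_polynomial {p : ℕ} (hp : p ≠ 0) (n : ℕ) :
    SplitsIdempotents (AddMonoidAlgebra k (perfExponents p n n)) := by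
  classical
  refine SplitsIdempotents.of_forall_finset fun s => ?_
  have hnat : ∀ γ : perfExponents p n n, ∃ M : ℕ, ∀ L, M ≤ L → ∀ i,
      ∃ m : ℕ, (γ : Fin n → ℚ) i * (p : ℚ) ^ L = m := by
    intro γ
    choose M m hm using fun i => (γ.2 i).1
    refine ⟨Finset.univ.sup M, fun L hL i => ?_⟩
    obtain ⟨l, rfl⟩ := Nat.exists_eq_add_of_le ((Finset.le_sup (Finset.mem_univ i)).trans hL)
    have h0 : 0 ≤ m i := by
      have : (0 : ℚ) ≤ m i := by
        rw [← hm]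
        exact mul_nonneg ((γ.2 i).2 i.2) (by positivity)
      exact_mod_cast this
    obtain ⟨m', hm'⟩ := Int.eq_ofNat_of_zero_le h0
    refine ⟨m' * p ^ l, ?_⟩
    rw [pow_add, ← mul_assoc, hm, hm']
    push_cast
    rfl
  choose M hM using hnat
  let L := (s.biUnion fun x => x.coeff.support).sup M
  have hp' : (p : ℚ) ^ L ≠ 0 := pow_ne_zero _ (Nat.cast_ne_zero.2 hp)
  let θ : (Fin n →₀ ℕ) →+ perfExponents p n n :=
    { toFun := fun v => ⟨fun i => v i * ((p : ℚ) ^ L)⁻¹, fun i =>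
        ⟨natCast_mul_mem_zInvP _ (inv_pow_mem_zInvP hp L), fun _ => by positivity⟩⟩
      map_zero' := Subtype.ext (funext fun i => by simp)
      map_add' := fun v w => Subtype.ext (funext fun i => by simp [add_mul]) }
  have hθ : Function.Injective θ := by
    intro v w h
    ext i
    have h1 := congrFun (congrArg Subtype.val h) i
    exact Nat.cast_injective (R := ℚ) (mul_right_cancel₀ (inv_ne_zero hp') h1)
  refine ⟨MvPolynomial (Fin n) k, inferInstance, AddMonoidAlgebra.mapDomainRingHom k θ,
    AddMonoidAlgebra.mapDomain_injective hθ, SplitsIdempotents.mvPolynomial k n,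
    fun x hx => AddMonoidAlgebra.mem_range_mapDomainRingHom θ fun γ hγ => ?_⟩
  choose m hm using hM γ L (Finset.le_sup (Finset.mem_biUnion.2 ⟨x, hx, hγ⟩))
  refine ⟨Finsupp.equivFunOnFinite.symm m, Subtype.ext (funext fun i => ?_)⟩
  change (m i : ℚ) * ((p : ℚ) ^ L)⁻¹ = _
  rw [← hm, mul_assoc, mul_inv_cancel₀ hp', mul_one]

open Classical in
/-- The endomorphism of `k[X_1^{1/p^∞}, …, X_n^{± 1/p^∞}]` that sets the first `r` variables, those
with nonnegative exponents, to zero. -/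
noncomputable def killNonnegVariables (k : Type u) [Field k] (p r n : ℕ) :
    AddMonoidAlgebra k (perfExponents p r n) →ₐ[k] AddMonoidAlgebra k (perfExponents p r n) :=
  AddMonoidAlgebra.lift k _ _
    { toFun := fun γ => if ∀ i : Fin n, i.val < r → (γ.toAdd : Fin n → ℚ) i = 0 then
        AddMonoidAlgebra.single γ.toAdd 1 else 0
      map_one' := by
        rw [if_pos]
        · rfl
        · exact fun i _ => rfl
      map_mul' := by
        intro γ δ
        have h : (∀ i : Fin n, i.val < r → ((γ * δ).toAdd : Fin n → ℚ) i = 0) ↔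
            (∀ i : Fin n, i.val < r → (γ.toAdd : Fin n → ℚ) i = 0) ∧
              ∀ i : Fin n, i.val < r → (δ.toAdd : Fin n → ℚ) i = 0 := by
          rw [← forall_and]
          refine forall_congr' fun i => ?_
          rw [← imp_and]
          refine forall_congr' fun hi => ?_
          exact add_eq_zero_iff_of_nonneg ((γ.toAdd.2 i).2 hi) ((δ.toAdd.2 i).2 hi)
        simp only [h]
        by_cases h1 : ∀ i : Fin n, i.val < r → (γ.toAdd : Fin n → ℚ) i = 0
        · by_cases h2 : ∀ i : Fin n, i.val < r → (δ.toAdd : Fin n → ℚ) i = 0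
          · rw [if_pos ⟨h1, h2⟩, if_pos h1, if_pos h2, AddMonoidAlgebra.single_mul_single, one_mul]
            rfl
          · rw [if_neg fun h => h2 h.2, if_neg h2, mul_zero]
        · rw [if_neg fun h => h1 h.1, if_neg h1, zero_mul] }

/-- Idempotents split over `k[X_1^{1/p^∞}, …, X_r^{1/p^∞}, X_{r+1}^{± 1/p^∞}, …, X_n^{± 1/p^∞}]`.
An idempotent matrix becomes free after inverting some `g` that does not vanish identically on
`X_1 = ⋯ = X_r = 0`. A monomial change of coordinates makes `g`, up to a monomial, comaximal with a
monomial in the invertible variables, so that the matrix comes from the subring without negative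
exponents by gluing. -/
theorem SplitsIdempotents.perfect_laurent {p : ℕ} (hp : 1 < p) {r n : ℕ} (hrn : r ≤ n) :
    SplitsIdempotents (AddMonoidAlgebra k (perfExponents p r n)) := by
  classical
  obtain rfl | hrn := hrn.eq_or_lt
  · exact .perfect_polynomial (by lia) _
  have hp0 : p ≠ 0 := by lia
  intro N E hE
  have hprime : (RingHom.ker (killNonnegVariables k p r n)).IsPrime := RingHom.ker_isPrime _
  obtain ⟨g, m, α, β, hg, hαβ, hβα, hαE, hEβ⟩ := exists_mul_eq_smul_of_isPrime
    (RingHom.ker (killNonnegVariables k p r n)) hE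
  have hS₀ : ∃ γ ∈ g.coeff.support, ∀ i : Fin n, i.val < r → (γ : Fin n → ℚ) i = 0 := by
    by_contra! h
    refine hg ?_
    rw [RingHom.mem_ker, killNonnegVariables, AddMonoidAlgebra.lift_apply]
    refine Finset.sum_eq_zero fun γ hγ => ?_
    obtain ⟨i, hi, hne⟩ := h γ hγ
    have h1 : ¬ ∀ i : Fin n, i.val < r → (γ : Fin n → ℚ) i = 0 := fun h => hne (h i hi)
    simp [h1]
  obtain ⟨Φ, _, hα₀S, hΦ, hΦ', hΦr, hα₀r, hpos⟩ := exists_linearEquiv_forall_pos hrn p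
    (g.coeff.support.image Subtype.val) (by
      intro α hα i hi
      obtain ⟨γ, -, rfl⟩ := Finset.mem_image.1 hα
      exact (γ.2 i).2 hi) (by
      obtain ⟨γ, hγ, h⟩ := hS₀
      exact ⟨_, Finset.mem_image.2 ⟨γ, hγ, rfl⟩, h⟩)
  obtain ⟨γ₀, hγ₀, rfl⟩ := Finset.mem_image.1 hα₀S
  have hΦr' : ∀ δ, ∀ i : Fin n, i.val < r → Φ.symm δ i = δ i := fun δ i hi => by
    rw [← hΦr (Φ.symm δ) i hi, LinearEquiv.apply_symm_apply]
  let θ : perfExponents p n n →+ perfExponents p r n :=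
    { toFun := fun δ => ⟨Φ.symm δ, fun i => ⟨hΦ' _ (fun j => (δ.2 j).1) i, fun hi => by
        rw [hΦr' _ i hi]
        exact (δ.2 i).2 (hi.trans hrn)⟩⟩
      map_zero' := Subtype.ext (map_zero Φ.symm)
      map_add' := fun γ δ => Subtype.ext (map_add Φ.symm _ _) }
  have hθ : Function.Injective θ := fun γ δ h =>
    Subtype.ext (Φ.symm.injective (congrArg Subtype.val h))
  have hθrange : ∀ γ : perfExponents p r n, (∀ i : Fin n, r ≤ i.val → 0 ≤ Φ γ i) →
      γ ∈ Set.range θ := by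
    intro γ hγ
    refine ⟨⟨Φ γ, fun i => ⟨hΦ _ (fun j => (γ.2 j).1) i, fun _ => ?_⟩⟩,
      Subtype.ext (Φ.symm_apply_apply _)⟩
    by_cases hi : i.val < r
    · rw [hΦr _ i hi]
      exact (γ.2 i).2 hi
    · exact hγ i (not_lt.1 hi)
  obtain ⟨M, hM⟩ := exists_inv_pow_le hp ((g.coeff.support.erase γ₀) ×ˢ
    (Finset.univ.filter fun i : Fin n => r ≤ i.val)) (fun x => Φ (x.1 - γ₀) x.2) (by
      rintro ⟨γ, i⟩ h
      obtain ⟨h1, h2⟩ := Finset.mem_product.1 h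
      obtain ⟨hne, hγ⟩ := Finset.mem_erase.1 h1
      exact hpos γ (Finset.mem_image.2 ⟨γ, hγ, rfl⟩) (fun h => hne (Subtype.ext h)) i
        (Finset.mem_filter.1 h2).2)
  let η : perfExponents p n n := ⟨fun i => if i.val < r then 0 else ((p : ℚ) ^ M)⁻¹, fun i => by
    beta_reduce
    split_ifs
    · exact ⟨zero_mem _, fun _ => le_rfl⟩
    · exact ⟨inv_pow_mem_zInvP hp0 M, fun _ => by positivity⟩⟩
  have hneg : ∀ δ : perfExponents p r n, (∀ i : Fin n, i.val < r → (δ : Fin n → ℚ) i = 0) →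
      -(δ : Fin n → ℚ) ∈ perfExponents p r n := fun δ h i =>
    ⟨neg_mem (δ.2 i).1, fun hi => by rw [Pi.neg_apply, h i hi, neg_zero]⟩
  have hηr : ∀ i : Fin n, i.val < r → (θ η : Fin n → ℚ) i = 0 := fun i hi => by
    change Φ.symm _ i = 0
    rw [hΦr' _ i hi]
    exact if_pos hi
  let nη : perfExponents p r n := ⟨_, hneg (θ η) hηr⟩
  let nγ₀ : perfExponents p r n := ⟨_, hneg γ₀ hα₀r⟩
  have hnη : θ η + nη = 0 := Subtype.ext (add_neg_cancel _)
  have hnγ₀ : γ₀ + nγ₀ = 0 := Subtype.ext (add_neg_cancel _)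
  let j := AddMonoidAlgebra.mapDomainRingHom k θ
  have hj : ∀ δ (a : k), j (AddMonoidAlgebra.single δ a) = AddMonoidAlgebra.single (θ δ) a :=
    fun δ a => AddMonoidAlgebra.mapDomain_single
  let h : AddMonoidAlgebra k (perfExponents p n n) := AddMonoidAlgebra.single η 1
  have hunit : IsUnit (j h) := by
    refine IsUnit.of_mul_eq_one (AddMonoidAlgebra.single nη 1) ?_
    rw [hj, AddMonoidAlgebra.single_mul_single, hnη, mul_one]
    rfl
  have hden : ∀ a, ∃ c : ℕ, j h ^ c * a ∈ j.range := by
    intro a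
    obtain ⟨c, hc⟩ := exists_nat_forall_add_mul_pos
      (a.coeff.support ×ˢ (Finset.univ : Finset (Fin n)))
      (fun x => Φ x.1 x.2) (fun _ => ((p : ℚ) ^ M)⁻¹) (fun _ _ => by positivity)
    refine ⟨c, ?_⟩
    rw [← AddMonoidAlgebra.sum_coeff_single a, hj, AddMonoidAlgebra.single_pow, one_pow,
      Finsupp.sum, Finset.mul_sum]
    refine sum_mem fun γ hγ => ?_
    rw [AddMonoidAlgebra.single_mul_single, one_mul]
    obtain ⟨δ, hδ⟩ := hθrange (c • θ η + γ) (by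
      intro i hi
      have h1 : Φ ((c • θ η + γ : perfExponents p r n) : Fin n → ℚ) =
          c • (η : Fin n → ℚ) + Φ γ := by
        change Φ (c • Φ.symm (η : Fin n → ℚ) + γ) = _
        rw [map_add, map_nsmul, LinearEquiv.apply_symm_apply]
      rw [h1]
      have h2 := hc (γ, i) (Finset.mk_mem_product hγ (Finset.mem_univ _))
      have h3 : (η : Fin n → ℚ) i = ((p : ℚ) ^ M)⁻¹ := if_neg (not_lt.2 hi)
      rw [Pi.add_apply, Pi.smul_apply, h3, nsmul_eq_mul]
      linarith)
    exact ⟨AddMonoidAlgebra.single δ _, by rw [hj, hδ]⟩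
  -- Up to the monomial with exponent `γ₀`, the element `g` is a nonzero constant modulo `h`.
  have hsum : (∑ γ ∈ g.coeff.support.erase γ₀,
      AddMonoidAlgebra.single (nη + (nγ₀ + γ)) (g.coeff γ)) ∈ j.range := by
    refine sum_mem fun γ hγ => ?_
    obtain ⟨δ, hδ⟩ := hθrange (nη + (nγ₀ + γ)) (by
      intro i hi
      have h1 : Φ ((nη + (nγ₀ + γ) : perfExponents p r n) : Fin n → ℚ) =
          Φ (γ - γ₀) - (η : Fin n → ℚ) := by
        change Φ (-Φ.symm (η : Fin n → ℚ) + (-(γ₀ : Fin n → ℚ) + γ)) = _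
        rw [map_add, map_neg, LinearEquiv.apply_symm_apply, neg_add_eq_sub, neg_add_eq_sub]
      have h3 : (η : Fin n → ℚ) i = ((p : ℚ) ^ M)⁻¹ := if_neg (not_lt.2 hi)
      rw [h1, Pi.sub_apply, h3, sub_nonneg]
      exact hM (γ, i) (Finset.mk_mem_product hγ (Finset.mem_filter.2 ⟨Finset.mem_univ _, hi⟩)))
    exact ⟨AddMonoidAlgebra.single δ _, by rw [hj, hδ]⟩
  obtain ⟨u, hu⟩ := hsum
  let c₀ := g.coeff γ₀
  have hc₀ : c₀ ≠ 0 := Finsupp.mem_support_iff.1 hγ₀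
  let g' : AddMonoidAlgebra k (perfExponents p n n) := AddMonoidAlgebra.single 0 c₀ + h * u
  have hg' : j g' = AddMonoidAlgebra.single nγ₀ 1 * g := by
    conv_rhs => rw [← AddMonoidAlgebra.sum_coeff_single g]
    rw [Finsupp.sum, ← Finset.add_sum_erase _ _ hγ₀, mul_add, Finset.mul_sum,
      AddMonoidAlgebra.single_mul_single, one_mul, add_comm nγ₀, hnγ₀, map_add, map_mul, hu,
      hj, hj, map_zero, Finset.mul_sum]
    congr 1
    refine Finset.sum_congr rfl fun γ _ => ?_
    rw [AddMonoidAlgebra.single_mul_single, AddMonoidAlgebra.single_mul_single, ← add_assoc, hnη,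
      zero_add]
  have hcop : IsCoprime h g' := by
    refine ⟨-(AddMonoidAlgebra.single 0 c₀⁻¹ * u), AddMonoidAlgebra.single 0 c₀⁻¹, ?_⟩
    have h1 : (AddMonoidAlgebra.single 0 c₀⁻¹ * AddMonoidAlgebra.single 0 c₀ :
        AddMonoidAlgebra k (perfExponents p n n)) = 1 := by
      rw [AddMonoidAlgebra.single_mul_single, inv_mul_cancel₀ hc₀, add_zero]
      rfl
    linear_combination h1
  refine (SplitsIdempotents.perfect_polynomial hp0 n).splits_of_isCoprime j
    (AddMonoidAlgebra.mapDomain_injective hθ) hunit hden hcop hE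
    (α := AddMonoidAlgebra.single nγ₀ (1 : k) • α) (β := β) ?_ ?_ ?_ hEβ
  · rw [Matrix.smul_mul, hαβ, smul_smul, hg']
  · rw [Matrix.mul_smul, hβα, smul_smul, hg']
  · rw [Matrix.smul_mul, hαE]

end MonoidAlgebra

/-! ### Reduction of restricted series modulo an open ideal -/

namespace RestrictedSeries

section Norm

variable {A : Type u} {Γ : Type v} [NormedCommRing A]

theorem _root_.Ideal.isClosed_of_ball_subset (I : Ideal A) {ε : ℝ} (hε : 0 < ε) (hI : ∀ a, ‖a‖ < ε → a ∈ I) :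
    IsClosed (I : Set A) :=
  AddSubgroup.isClosed_of_isOpen I.toAddSubgroup <|
    I.toAddSubgroup.isOpen_of_mem_nhds (g := 0) <|
      Filter.mem_of_superset (Metric.ball_mem_nhds 0 hε) fun a ha => hI a (by simpa using ha)

theorem exists_norm_coeff_le {f : RestrictedSeries A Γ} (hf : ∀ γ, ‖f.coeff γ‖ < 1) :
    ∃ ρ : ℝ, 0 ≤ ρ ∧ ρ < 1 ∧ ∀ γ, ‖f.coeff γ‖ ≤ ρ := by
  -- Only finitely many coefficients have norm at least `1 / 2`, so the bound `1 / 2` can fail only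
  -- at finitely many exponents.
  by_cases hne : (f.finite_le_norm (1 / 2) (by norm_num)).toFinset.Nonempty
  · obtain ⟨δ, hδ, hmax⟩ := Finset.exists_max_image _ (fun γ => ‖f.coeff γ‖) hne
    have hδ' : 1 / 2 ≤ ‖f.coeff δ‖ := by simpa using hδ
    refine ⟨‖f.coeff δ‖, norm_nonneg _, hf δ, fun γ => ?_⟩
    by_cases h : 1 / 2 ≤ ‖f.coeff γ‖
    · exact hmax γ (by simpa using h)
    · exact (not_le.1 h).le.trans hδ'
  · refine ⟨1 / 2, by norm_num, by norm_num, fun γ => ?_⟩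
    by_contra! h
    exact hne ⟨γ, by simpa using h.le⟩

theorem norm_coeff_mul_le [IsUltrametricDist A] [AddCommMonoid Γ] {f g : RestrictedSeries A Γ} {b c : ℝ} (hb : 0 ≤ b) (hc : 0 ≤ c)
    (hf : ∀ γ, ‖f.coeff γ‖ ≤ b) (hg : ∀ γ, ‖g.coeff γ‖ ≤ c) (γ : Γ) :
    ‖(f * g).coeff γ‖ ≤ b * c :=
  IsUltrametricDist.norm_tsum_le_of_forall_le_of_nonneg (mul_nonneg hb hc) fun _ =>
    (norm_mul_le _ _).trans (mul_le_mul (hf _) (hg _) (norm_nonneg _) hb)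

end Norm

section Reduce

variable {A : Type u} {Γ : Type v} [NormedCommRing A] [IsUltrametricDist A] [CompleteSpace A]
  [AddCommMonoid Γ]

open Classical in
/-- Reduction of the coefficients of a restricted series modulo an ideal `I` that contains a ball
around zero: the result is a finite sum. -/
noncomputable def reduce (I : Ideal A) {ε : ℝ} (hε : 0 < ε) (hI : ∀ a, ‖a‖ < ε → a ∈ I) :
    RestrictedSeries A Γ →+* AddMonoidAlgebra (A ⧸ I) Γ where
  toFun f := .ofCoeff (Finsupp.onFinset (f.finite_le_norm ε hε).toFinset
    (fun γ => Ideal.Quotient.mk I (f.coeff γ)) fun γ h => by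
      rw [Set.Finite.mem_toFinset, Set.mem_ofPred_eq]
      by_contra! h'
      exact h (Ideal.Quotient.eq_zero_iff_mem.2 (hI _ h')))
  map_one' := by
    ext γ
    change Ideal.Quotient.mk I ((Pi.single 0 1 : Γ → A) γ) = _
    rw [AddMonoidAlgebra.one_def, AddMonoidAlgebra.coeff_single, Pi.single_apply,
      Finsupp.single_apply, apply_ite (Ideal.Quotient.mk I), map_one, map_zero]
    simp only [eq_comm]
  map_zero' := by
    ext γ
    exact map_zero (Ideal.Quotient.mk I)
  map_add' f g := by
    ext γ
    exact map_add (Ideal.Quotient.mk I) _ _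
  map_mul' f g := by
    ext γ
    change Ideal.Quotient.mk I ((f * g).coeff γ) = _
    set F := (f.finite_le_norm ε hε).toFinset
    set G := (g.finite_le_norm ε hε).toFinset
    let T : Finset {x : Γ × Γ // x.1 + x.2 = γ} :=
      (F ×ˢ G).subtype fun x => x.1 + x.2 = γ
    have htail : ∑' x : ((T : Set {x : Γ × Γ // x.1 + x.2 = γ})ᶜ : Set _),
        f.coeff x.1.1.1 * g.coeff x.1.1.2 ∈ I := by
      refine tsum_mem (I.isClosed_of_ball_subset hε hI) (s := I.toAddSubgroup) fun x => ?_
      have hx : ¬ (ε ≤ ‖f.coeff x.1.1.1‖ ∧ ε ≤ ‖g.coeff x.1.1.2‖) := by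
        rintro ⟨h1, h2⟩
        refine x.2 ?_
        rw [Finset.mem_coe, Finset.mem_subtype, Finset.mem_product]
        exact ⟨(Set.Finite.mem_toFinset _).2 h1, (Set.Finite.mem_toFinset _).2 h2⟩
      rw [not_and_or, not_le, not_le] at hx
      exact hx.elim (fun h => I.mul_mem_right _ (hI _ h)) fun h => I.mul_mem_left _ (hI _ h)
    rw [RestrictedSeries.coeff_mul, ← (summable_mul f g γ).sum_add_tsum_compl (s := T), map_add,
      Ideal.Quotient.eq_zero_iff_mem.2 htail, add_zero, map_sum, AddMonoidAlgebra.coeff_mul]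
    rw [AddMonoidAlgebra.coeff_ofCoeff, AddMonoidAlgebra.coeff_ofCoeff, Finsupp.onFinset_sum]
    swap
    · intro a; simp
    rw [Finset.sum_congr rfl fun a _ => Finsupp.onFinset_sum _ fun _ => by simp]
    rw [← Finset.sum_product', ← Finset.sum_filter,
      ← Finset.sum_subtype_eq_sum_filter (p := fun x : Γ × Γ => x.1 + x.2 = γ)]
    exact Finset.sum_congr rfl fun _ _ => map_mul (Ideal.Quotient.mk I) _ _

theorem coeff_reduce (I : Ideal A) {ε : ℝ} (hε : 0 < ε) (hI : ∀ a, ‖a‖ < ε → a ∈ I)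
    (f : RestrictedSeries A Γ) (γ : Γ) :
    (reduce I hε hI f).coeff γ = Ideal.Quotient.mk I (f.coeff γ) := rfl

theorem reduce_single (I : Ideal A) {ε : ℝ} (hε : 0 < ε) (hI : ∀ a, ‖a‖ < ε → a ∈ I)
    (γ : Γ) (a : A) : reduce I hε hI (single γ a) =
      AddMonoidAlgebra.single γ (Ideal.Quotient.mk I a) := by
  classical
  ext δ
  rw [coeff_reduce]
  change Ideal.Quotient.mk I ((Pi.single γ a : Γ → A) δ) = _
  rw [AddMonoidAlgebra.coeff_single, Pi.single_apply, Finsupp.single_apply,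
    apply_ite (Ideal.Quotient.mk I), map_zero]
  simp only [eq_comm]

theorem reduce_surjective (I : Ideal A) {ε : ℝ} (hε : 0 < ε) (hI : ∀ a, ‖a‖ < ε → a ∈ I) :
    Function.Surjective (reduce (Γ := Γ) I hε hI) := by
  intro y
  change y ∈ (reduce (Γ := Γ) I hε hI).range
  rw [← AddMonoidAlgebra.sum_coeff_single y]
  refine sum_mem fun γ _ => ?_
  obtain ⟨a, ha⟩ := Ideal.Quotient.mk_surjective (y.coeff γ)
  exact ⟨single γ a, by rw [reduce_single, ha]⟩

theorem norm_coeff_pow_le (hA : ∀ a : A, ‖a‖ ≤ 1) {f : RestrictedSeries A Γ} {ρ : ℝ} (hρ : 0 ≤ ρ)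
    (hf : ∀ γ, ‖f.coeff γ‖ ≤ ρ) (n : ℕ) (γ : Γ) : ‖(f ^ n).coeff γ‖ ≤ ρ ^ n := by
  induction n generalizing γ with
  | zero => simpa using hA _
  | succ n ih =>
    rw [pow_succ, pow_succ]
    exact norm_coeff_mul_le (pow_nonneg hρ n) hρ ih hf γ

theorem coeff_sum {ι : Type*} (s : Finset ι) (f : ι → RestrictedSeries A Γ) (γ : Γ) :
    (∑ i ∈ s, f i).coeff γ = ∑ i ∈ s, (f i).coeff γ :=
  map_sum (⟨⟨fun f => f.coeff γ, rfl⟩, fun _ _ => rfl⟩ : RestrictedSeries A Γ →+ A) f s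

/-- A series whose coefficients are those of `1` up to elements of norm less than one is a unit:
its inverse is a geometric series, summed coefficientwise. -/
theorem isUnit_of_norm_coeff_sub_lt_one (hA : ∀ a : A, ‖a‖ ≤ 1) {f : RestrictedSeries A Γ}
    (hf : ∀ γ, ‖(1 - f).coeff γ‖ < 1) : IsUnit f := by
  obtain ⟨ρ, hρ0, hρ1, hρ⟩ := exists_norm_coeff_le hf
  set h := 1 - f with hh
  have hfh : f = 1 - h := by rw [hh, sub_sub_cancel]
  have hpow := norm_coeff_pow_le hA hρ0 hρ
  have hρlim : Tendsto (fun n : ℕ => ρ ^ n) atTop (𝓝 0) :=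
    tendsto_pow_atTop_nhds_zero_of_lt_one hρ0 hρ1
  have hsum : ∀ γ, Summable fun n : ℕ => (h ^ n).coeff γ := fun γ =>
    Summable.of_norm_bounded (summable_geometric_of_lt_one hρ0 hρ1) fun n => hpow n γ
  -- The tails of the geometric series are small, uniformly in the exponent.
  have htail : ∀ N γ, ‖∑' n, (h ^ n).coeff γ - (∑ n ∈ Finset.range N, h ^ n).coeff γ‖ ≤ ρ ^ N := by
    intro N γ
    rw [coeff_sum, ← (hsum γ).sum_add_tsum_nat_add N, add_sub_cancel_left]
    refine IsUltrametricDist.norm_tsum_le_of_forall_le_of_nonneg (pow_nonneg hρ0 N) fun n => ?_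
    exact (hpow _ γ).trans (pow_le_pow_of_le_one hρ0 hρ1.le (Nat.le_add_left N n))
  let G : RestrictedSeries A Γ := ⟨fun γ => ∑' n, (h ^ n).coeff γ, fun ε hε => by
    obtain ⟨N, hN⟩ := (hρlim.eventually_lt_const hε).exists
    refine ((∑ n ∈ Finset.range N, h ^ n).finite_le_norm ε hε).subset fun γ hγ => ?_
    change ε ≤ ‖_‖
    by_contra! hlt
    have h3 := IsUltrametricDist.norm_add_le_max
      (∑' n, (h ^ n).coeff γ - (∑ n ∈ Finset.range N, h ^ n).coeff γ)
      ((∑ n ∈ Finset.range N, h ^ n).coeff γ)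
    rw [sub_add_cancel] at h3
    exact (h3.trans_lt (max_lt ((htail N γ).trans_lt hN) hlt)).not_ge hγ⟩
  refine IsUnit.of_mul_eq_one G (sub_eq_zero.1 ?_)
  ext γ
  -- `f * G - 1` differs from `f * ∑_{n < N} h ^ n - 1 = - h ^ N` by a multiple of a tail.
  refine norm_le_zero_iff.1 (ge_of_tendsto' hρlim fun N => ?_)
  have h4 : f * G - 1 = f * (G - ∑ n ∈ Finset.range N, h ^ n) - h ^ N := by
    have := mul_neg_geom_sum h N
    rw [← hfh] at this
    rw [mul_sub, this]
    ring
  rw [h4]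
  rw [sub_eq_add_neg, coeff_add]
  refine (IsUltrametricDist.norm_add_le_max _ _).trans
    (max_le ?_ ((norm_neg ((h ^ N).coeff γ)).trans_le (hpow N γ)))
  have h5 := norm_coeff_mul_le zero_le_one (pow_nonneg hρ0 N) (fun δ => hA (f.coeff δ)) (htail N) γ
    (g := G - ∑ n ∈ Finset.range N, h ^ n)
  rwa [one_mul] at h5

end Reduce

end RestrictedSeries

/-! ### Reduction to the residue field -/

section PerfectoidField

variable {K : Type u} [NormedField K] [IsUltrametricDist K]

theorem mem_valRing {x : K} : x ∈ valRing K ↔ ‖x‖ ≤ 1 := by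
  simp [Valuation.mem_integer_iff, NormedField.valuation_apply, ← NNReal.coe_le_coe]

theorem valRing_norm_le_one (a : valRing K) : ‖a‖ ≤ 1 := mem_valRing.1 a.2

variable (K) in
/-- The maximal ideal of the valuation ring. -/
def valMaximalIdeal : Ideal (valRing K) where
  carrier := {a | ‖a‖ < 1}
  zero_mem' := by simp
  add_mem' := fun {a b} ha hb =>
    (IsUltrametricDist.norm_add_le_max a b).trans_lt (max_lt ha hb)
  smul_mem' := fun c a ha => by
    change ‖(c : K) * a‖ < 1
    rw [norm_mul]
    exact mul_lt_one_of_nonneg_of_lt_one_right (valRing_norm_le_one c) (norm_nonneg _) ha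

theorem mem_valMaximalIdeal {a : valRing K} : a ∈ valMaximalIdeal K ↔ ‖a‖ < 1 := Iff.rfl

instance : (valMaximalIdeal K).IsMaximal := by
  rw [Ideal.isMaximal_iff]
  refine ⟨fun h => ?_, fun J a hJ ha haJ => ?_⟩
  · have h1 : ‖(1 : K)‖ < 1 := h
    simp at h1
  · have h1 : ‖(a : K)‖ = 1 := le_antisymm (valRing_norm_le_one a) (not_lt.1 ha)
    have h0 : (a : K) ≠ 0 := fun h => by simp [h] at h1
    let b : valRing K := ⟨(a : K)⁻¹, mem_valRing.2 (by rw [norm_inv, h1, inv_one])⟩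
    have hb : b * a = 1 := Subtype.ext (inv_mul_cancel₀ h0)
    rw [← hb]
    exact J.mul_mem_left b haJ

theorem IsPseudouniformizer.norm_lt_one {ϖ : valRing K} (hϖ : IsPseudouniformizer K ϖ) :
    ‖(ϖ : K)‖ < 1 := by
  have h1 : Tendsto (fun n : ℕ => (ϖ : K) ^ n) atTop (𝓝 0) := hϖ.topologicallyNilpotent
  obtain ⟨n, hn⟩ := (Metric.tendsto_nhds.1 h1 1 one_pos).exists
  rw [dist_zero_right, norm_pow] at hn
  by_contra! h
  exact hn.not_ge (one_le_pow₀ h)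

theorem IsPseudouniformizer.mem_span_pow {ϖ : valRing K} (hϖ : IsPseudouniformizer K ϖ) (d : ℕ)
    {a : valRing K} (ha : ‖a‖ < ‖(ϖ : K)‖ ^ d) : a ∈ Ideal.span {ϖ ^ d} := by
  have h0 : (ϖ : K) ^ d ≠ 0 := pow_ne_zero _ hϖ.ne_zero
  rw [Ideal.mem_span_singleton]
  refine ⟨⟨(a : K) / (ϖ : K) ^ d, mem_valRing.2 ?_⟩, Subtype.ext ?_⟩
  · rw [norm_div, norm_pow]
    exact div_le_one_of_le₀ ha.le (by positivity)
  · exact (mul_div_cancel₀ _ h0).symm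

variable (p r n : ℕ)

theorem splitsIdempotents_residueField (hp : 1 < p) (hrn : r ≤ n) : SplitsIdempotents
    (AddMonoidAlgebra (valRing K ⧸ valMaximalIdeal K) (perfExponents p r n)) := by
  let F : Field (valRing K ⧸ valMaximalIdeal K) := Ideal.Quotient.field _
  exact SplitsIdempotents.perfect_laurent (k := valRing K ⧸ valMaximalIdeal K) hp hrn

variable [CompleteSpace K]

variable (K) in
/-- Reduction of a restricted series over `K°` modulo the maximal ideal. -/
noncomputable def residueHom : IntegralPerfLaurent K p r n →+*
    AddMonoidAlgebra (valRing K ⧸ valMaximalIdeal K) (perfExponents p r n) :=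
  RestrictedSeries.reduce (valMaximalIdeal K) one_pos fun _ => mem_valMaximalIdeal.2

variable {p r n}

theorem coeff_residueHom (f : IntegralPerfLaurent K p r n) (γ : perfExponents p r n) :
    (residueHom K p r n f).coeff γ = Ideal.Quotient.mk _ (f.coeff γ) := rfl

theorem residueHom_surjective : Function.Surjective (residueHom K p r n) :=
  RestrictedSeries.reduce_surjective _ _ _

theorem residueHom_C {a : valRing K} (ha : a ∈ valMaximalIdeal K) :
    residueHom K p r n (RestrictedSeries.C a) = 0 := by
  refine (RestrictedSeries.reduce_single (valMaximalIdeal K) one_pos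
    (fun _ => mem_valMaximalIdeal.2) 0 a).trans ?_
  rw [Ideal.Quotient.eq_zero_iff_mem.2 ha, AddMonoidAlgebra.single_zero]

theorem isUnit_of_residueHom_eq_one {f : IntegralPerfLaurent K p r n}
    (hf : residueHom K p r n f = 1) : IsUnit f := by
  refine RestrictedSeries.isUnit_of_norm_coeff_sub_lt_one valRing_norm_le_one fun γ => ?_
  have h1 : residueHom K p r n (1 - f) = 0 := by rw [map_sub, hf, map_one, sub_self]
  have h2 : Ideal.Quotient.mk (valMaximalIdeal K) ((1 - f).coeff γ) = 0 := by
    rw [← coeff_residueHom, h1, AddMonoidAlgebra.coeff_zero, Finsupp.zero_apply]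
  exact mem_valMaximalIdeal.1 (Ideal.Quotient.eq_zero_iff_mem.1 h2)

theorem splitsIdempotents_integralPerfLaurent (hp : 1 < p) (hrn : r ≤ n) :
    SplitsIdempotents (IntegralPerfLaurent K p r n) :=
  (splitsIdempotents_residueField p r n hp hrn).of_surjective (residueHom K p r n)
    residueHom_surjective fun _ => isUnit_of_residueHom_eq_one

theorem splitsIdempotents_integralPerfLaurent_quotient (hp : 1 < p) (hrn : r ≤ n)
    {a : valRing K} (ha : a ∈ valMaximalIdeal K) :
    SplitsIdempotents (IntegralPerfLaurent K p r n ⧸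
      Ideal.span {(RestrictedSeries.C a : IntegralPerfLaurent K p r n)}) := by
  have hker : ∀ f ∈ Ideal.span {(RestrictedSeries.C a : IntegralPerfLaurent K p r n)},
      residueHom K p r n f = 0 := by
    intro f hf
    obtain ⟨g, rfl⟩ := Ideal.mem_span_singleton.1 hf
    rw [map_mul, residueHom_C ha, zero_mul]
  refine (splitsIdempotents_residueField p r n hp hrn).of_surjective
    (Ideal.Quotient.lift _ (residueHom K p r n) hker)
    (Ideal.Quotient.lift_surjective_of_surjective _ hker residueHom_surjective) fun b hb => ?_
  obtain ⟨f, rfl⟩ := Ideal.Quotient.mk_surjective b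
  exact (isUnit_of_residueHom_eq_one hb).map (Ideal.Quotient.mk _)

/-- The coefficientwise reduction of `(K° ⧸ I)[Γ]` modulo the maximal ideal detects units because
it is dominated by the reduction of restricted series. -/
theorem splitsIdempotents_addMonoidAlgebra_quotient (hp : 1 < p) (hrn : r ≤ n)
    {I : Ideal (valRing K)} (hle : I ≤ valMaximalIdeal K) {ε : ℝ} (hε : 0 < ε)
    (hI : ∀ a, ‖a‖ < ε → a ∈ I) :
    SplitsIdempotents (AddMonoidAlgebra (valRing K ⧸ I) (perfExponents p r n)) := by
  let q := RestrictedSeries.reduce (Γ := perfExponents p r n) I hε hI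
  have hq : Function.Surjective q := RestrictedSeries.reduce_surjective _ _ _
  let s := AddMonoidAlgebra.mapRingHom (perfExponents p r n) (Ideal.Quotient.factor hle)
  have hsq : ∀ f, s (q f) = residueHom K p r n f := by
    intro f
    ext γ
    rw [AddMonoidAlgebra.coeff_mapRingHom, coeff_residueHom]
    rfl
  refine (splitsIdempotents_residueField p r n hp hrn).of_surjective s (fun y => ?_) fun a ha => ?_
  · obtain ⟨f, rfl⟩ := residueHom_surjective y
    exact ⟨q f, hsq f⟩
  · obtain ⟨f, rfl⟩ := hq a
    exact (isUnit_of_residueHom_eq_one ((hsq f).symm.trans ha)).map q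

end PerfectoidField

theorem mainTheorem8 (p : ℕ) (K : Type u) [NormedField K] [IsUltrametricDist K] [CompleteSpace K]
    (hK : IsPerfectoidField K p) (ϖ : valRing K) (hϖ : IsPseudouniformizer K ϖ)
    (r n : ℕ) (hrn : r ≤ n) :
    FiniteProjectiveFree.{u, v} (IntegralPerfLaurent K p r n) ∧
    (∀ d : ℕ, 0 < d →
      FiniteProjectiveFree.{u, v} (IntegralPerfLaurent K p r n ⧸
        Ideal.span {(RestrictedSeries.C ϖ ^ d : IntegralPerfLaurent K p r n)})) ∧
    (∀ d : ℕ, 0 < d → FiniteProjectiveFree.{u, v} (TruncatedPerfLaurent K ϖ d p r n)) := by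
  have hp : 1 < p := hK.prime.one_lt
  have hmem : ∀ d : ℕ, 0 < d → ϖ ^ d ∈ valMaximalIdeal K := fun d hd =>
    Ideal.pow_mem_of_mem _ hϖ.norm_lt_one d hd
  refine ⟨(splitsIdempotents_integralPerfLaurent hp hrn).finiteProjectiveFree,
    fun d hd => ?_, fun d hd => ?_⟩
  · rw [← map_pow]
    exact (splitsIdempotents_integralPerfLaurent_quotient hp hrn
      (hmem d hd)).finiteProjectiveFree
  · exact (splitsIdempotents_addMonoidAlgebra_quotient hp hrn
      ((Ideal.span_singleton_le_iff_mem _).2 (hmem d hd))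
      (pow_pos (norm_pos_iff.2 hϖ.ne_zero) d)
      fun _ => hϖ.mem_span_pow d).finiteProjectiveFree
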